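/- Let $k$ be an algebraically closed field of characteristic $0$ (for example $k=\mathbb{C}$), and let $X=\{F=0\}\subset\mathbb{P}^4_k$ be a smooth quartic hypersurface, where $F\in k[x_0,\dots,x_4]$ is homogeneous of degree $4$ and $F$ and its partial derivatives $\partial F/\partial x_0,\dots,\partial F/\partial x_4$ have no common zero in $\mathbb{P}^4$. Let $\mathbb{G}(1,4)\subset\mathbb{P}^9$ be the Grassmannian of lines in $\mathbb{P}^4$, with the Zariski topology given by its Pl\"ucker embedding. Then the Fano variety $$F_1(X)=\{L\in\mathbb{G}(1,4) : L\subset X\}$$ of lines on $X$ is nonempty and has pure dimension one; that is, every irreducible component of $F_1(X)$ has dimension $1$. -/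

import Mathlib

open scoped LinearAlgebra.Projectivization

namespace FanoLines

/-- The Zariski topology on the projective space `ℙ k (ι → k)`, generated by the basic open sets
`{p | f(p) ≠ 0}` with `f` a homogeneous polynomial (these are stable under finite intersections,
so the closed sets are exactly the common zero loci of families of homogeneous polynomials).
For homogeneous `f`, nonvanishing does not depend on the representative `p.rep`. -/
abbrev zariskiTopology (k : Type*) [Field k] (ι : Type*) : TopologicalSpace (ℙ k (ι → k)) :=
  TopologicalSpace.generateFrom
    {U | ∃ (d : ℕ) (f : MvPolynomial ι k), f.IsHomogeneous d ∧
      U = {p : ℙ k (ι → k) | MvPolynomial.eval p.rep f ≠ 0}}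

/-- The hypersurface in `ℙ⁴` defined by a (homogeneous) polynomial `F`, as a set of points. -/
def hypersurface {k : Type*} [Field k] (F : MvPolynomial (Fin 5) k) :
    Set (ℙ k (Fin 5 → k)) :=
  {p | MvPolynomial.eval p.rep F = 0}

/-- The hypersurface `F = 0` in `ℙ⁴` is smooth: the partial derivatives of `F` have no common
zero on it. -/
def IsSmoothHypersurface {k : Type*} [Field k] (F : MvPolynomial (Fin 5) k) : Prop :=
  ∀ p ∈ hypersurface F, ∃ i : Fin 5, MvPolynomial.eval p.rep (MvPolynomial.pderiv i F) ≠ 0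

/-- The Grassmannian `𝔾(1, 4)` of lines in `ℙ⁴`, that is, of two-dimensional linear subspaces
of `k⁵`. -/
def LineGrassmannian (k : Type*) [Field k] : Type _ :=
  {L : Submodule k (Fin 5 → k) // Module.finrank k L = 2}

/-- The line in `ℙ⁴` that corresponds to a point of the Grassmannian. -/
def LineGrassmannian.line {k : Type*} [Field k] (L : LineGrassmannian k) :
    Set (ℙ k (Fin 5 → k)) :=
  {p | p.submodule ≤ L.1}

/-- The ten pairs `i < j` that index the Plücker coordinates. -/
abbrev PluckerIndex : Type :=
  {ij : Fin 5 × Fin 5 // ij.1 < ij.2}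

/-- The vector of the `2 × 2` minors of the matrix with rows `v` and `w`. -/
def pluckerVector {k : Type*} [Field k] (v w : Fin 5 → k) : PluckerIndex → k :=
  fun ij => v ij.1.1 * w ij.1.2 - v ij.1.2 * w ij.1.1

theorem pluckerVector_ne_zero {k : Type*} [Field k] {v w : Fin 5 → k}
    (h : LinearIndependent k ![v, w]) : pluckerVector v w ≠ 0 := by
  intro h0
  have hlt : ∀ i j : Fin 5, i < j → v i * w j = v j * w i := fun i j hij =>
    sub_eq_zero.mp (congrFun h0 ⟨(i, j), hij⟩)
  have hall : ∀ i j : Fin 5, v i * w j = v j * w i := by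
    intro i j
    rcases lt_trichotomy i j with hij | rfl | hij
    · exact hlt i j hij
    · rfl
    · exact (hlt j i hij).symm
  have hv : v ≠ 0 := h.ne_zero 0
  obtain ⟨i, hi⟩ := Function.ne_iff.mp hv
  have hp := LinearIndependent.pair_iff.mp h (w i) (-v i) (by
    ext j
    have := hall i j
    simp only [Pi.add_apply, Pi.smul_apply, smul_eq_mul, Pi.zero_apply]
    linear_combination -this)
  exact hi (neg_eq_zero.mp hp.2)

/-- A basis of the two-dimensional space `L`. -/
noncomputable def LineGrassmannian.basis {k : Type*} [Field k] (L : LineGrassmannian k) :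
    Module.Basis (Fin 2) k L.1 :=
  Module.finBasisOfFinrankEq k L.1 L.2

theorem LineGrassmannian.linearIndependent_basis {k : Type*} [Field k] (L : LineGrassmannian k) :
    LinearIndependent k ![(L.basis 0 : Fin 5 → k), (L.basis 1 : Fin 5 → k)] := by
  have h := L.basis.linearIndependent.map' L.1.subtype (Submodule.ker_subtype _)
  have e : ![(L.basis 0 : Fin 5 → k), (L.basis 1 : Fin 5 → k)] = L.1.subtype ∘ L.basis := by
    funext i
    fin_cases i <;> rfl
  rw [e]
  exact h

/-- The Plücker embedding `𝔾(1, 4) → ℙ⁹`. The choice of basis changes the vector of minors only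
by a nonzero scalar, hence does not affect the point. -/
noncomputable def plucker {k : Type*} [Field k] (L : LineGrassmannian k) :
    ℙ k (PluckerIndex → k) :=
  Projectivization.mk k (pluckerVector (L.basis 0 : Fin 5 → k) (L.basis 1 : Fin 5 → k))
    (pluckerVector_ne_zero L.linearIndependent_basis)

/-- The Zariski topology on `𝔾(1, 4)`, induced by the Plücker embedding. -/
noncomputable instance instTopologicalSpaceLineGrassmannian (k : Type*) [Field k] :
    TopologicalSpace (LineGrassmannian k) :=
  TopologicalSpace.induced plucker (zariskiTopology k PluckerIndex)

/-- The Fano variety `F₁(X) ⊆ 𝔾(1, 4)` of lines contained in `X ⊆ ℙ⁴`; as a subset of the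
Grassmannian it carries the subspace topology. -/
def fanoVariety {k : Type*} [Field k] (X : Set (ℙ k (Fin 5 → k))) :
    Set (LineGrassmannian k) :=
  {L | L.line ⊆ X}

/-- A topological space has pure dimension `d` if each of its irreducible components has Krull
dimension `d`. -/
def HasPureDimension (T : Type*) [TopologicalSpace T] (d : ℕ) : Prop :=
  ∀ Z ∈ irreducibleComponents T, topologicalKrullDim Z = d

end FanoLines

/-! In an affine chart of the Grassmannian a line has six coordinates, and it lies on the quartic
iff the restriction of `F`, of degree at most 4 in one parameter, vanishes at 0, ..., 4: five
equations in six unknowns. By Krull's height theorem (`exists_isPrime_lt_vanishingIdeal`) a common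
zero is never isolated, so every component has dimension at least one
(`one_le_topologicalKrullDim_of_mem_irreducibleComponents`).

For existence (`exists_line_on_quartic`), `F` is joined by a pencil with parameter `T` to a special
quartic for which the chart equations are linear. A dimension count near its line at the origin
gives a line on the member with transcendental `T` (`exists_line_in_pencil`). A valuation
specialises `T` to 1; normalised Plücker coordinates specialise with it, which is properness of the
Grassmannian, and a line on `F` results.

For the upper bound (`topologicalKrullDim_fanoVariety_le_one`), a chain of three irreducible closed
sets gives a generic line over a function field `K` with two independent `k`-derivations. Each
derivation is a first-order deformation of the line, that is, a linear syzygy between three partials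
of `F` restricted to the line. Smoothness makes these binary cubics coprime, and any two linear
syzygies are then proportional (`linear_syzygies_proportional`): the normal bundle has rank two and
degree -1, so all its sections lie in one line subbundle. With two independent deformations, all of
them move the line in a single direction `c` (`exists_common_direction`). Commuting derivations show
that `c` is constant, so the lines sweep out a fixed plane contained in the hypersurface
(`not_exists_independent_derivations`). This is impossible: on a plane in the hypersurface the two
transverse derivatives of `F` have a common zero, which is a singular point
(`not_forall_eval_span_triple_eq_zero`). -/

namespace FanoLines

/-! ### Dimension theory of affine space at a closed point. -/

section Krull

open MvPolynomial

variable {k : Type*} [Field k] {σ : Type*}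

theorem aeval_eq_eval_self (x : σ → k) (f : MvPolynomial σ k) : aeval x f = eval x f := by
  rw [← coe_aeval_eq_eval]
  rfl

/-- Translation by `x` as an automorphism of the polynomial ring. -/
noncomputable def translate (x : σ → k) : MvPolynomial σ k ≃ₐ[k] MvPolynomial σ k :=
  AlgEquiv.ofAlgHom (aeval fun i => X i + C (x i)) (aeval fun i => X i - C (x i))
    (by ext i; simp [algHom_C, MvPolynomial.algebraMap_eq])
    (by ext i; simp [algHom_C, MvPolynomial.algebraMap_eq])

theorem eval_translate (x y : σ → k) (f : MvPolynomial σ k) :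
    eval y (translate x f) = eval (y + x) f := by
  have : (aeval y).comp (translate x).toAlgHom = aeval (R := k) (y + x) := by
    ext i; simp [translate]
  have h := DFunLike.congr_fun this f
  simpa [coe_aeval_eq_eval] using h

variable [IsAlgClosed k] [Finite σ]

/-- Translations act transitively on points, so by the Nullstellensatz all maximal ideals have the
same height, which must then be the Krull dimension of the polynomial ring. -/
theorem height_vanishingIdeal_singleton (x : σ → k) :
    (vanishingIdeal k {x}).height = Nat.card σ := by
  have key : ∀ x y : σ → k,
      (vanishingIdeal k {x}).height = (vanishingIdeal k {y}).height := by
    intro x y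
    have : vanishingIdeal k {y} =
        (vanishingIdeal k {x}).comap (translate (y - x)).toRingEquiv := by
      ext f
      have := eval_translate (y - x) x f
      rw [add_sub_cancel] at this
      rw [Ideal.mem_comap, mem_vanishingIdeal_singleton_iff, mem_vanishingIdeal_singleton_iff]
      change eval y f = 0 ↔ eval x (translate (y - x) f) = 0
      rw [this]
    rw [this, RingEquiv.height_comap]
  apply le_antisymm
  · have h := Ideal.height_le_ringKrullDim_of_ne_top (I := vanishingIdeal k {x})
      Ideal.IsPrime.ne_top'
    simp only [ringKrullDim_of_isNoetherianRing, ringKrullDim_eq_zero_of_field, zero_add] at h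
    exact_mod_cast h
  · have h : ringKrullDim (MvPolynomial σ k) ≤ ((vanishingIdeal k {x}).height : WithBot ℕ∞) := by
      refine (ringKrullDim_le_iff_isMaximal_height_le _).mpr fun M hM ↦ ?_
      obtain ⟨y, rfl⟩ := isMaximal_iff_eq_vanishingIdeal_singleton.mp hM
      rw [key y x]
    simp only [ringKrullDim_of_isNoetherianRing, ringKrullDim_eq_zero_of_field, zero_add] at h
    exact_mod_cast h

/-- Fewer equations than variables: a common zero is never isolated. -/
theorem exists_isPrime_lt_vanishingIdeal {ι : Type*} [Finite ι] (hc : Nat.card ι < Nat.card σ)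
    (f : ι → MvPolynomial σ k) (x : σ → k) (hx : ∀ i, eval x (f i) = 0) :
    ∃ Q : Ideal (MvPolynomial σ k), Q.IsPrime ∧ (∀ i, f i ∈ Q) ∧ Q < vanishingIdeal k {x} := by
  have hle : Ideal.span (Set.range f) ≤ vanishingIdeal k {x} := by
    rw [Ideal.span_le]
    rintro _ ⟨i, rfl⟩
    simpa [coe_aeval_eq_eval] using hx i
  obtain ⟨Q, hQ, hQx⟩ := Ideal.exists_minimalPrimes_le hle
  refine ⟨Q, hQ.1.1, fun i => hQ.1.2 (Ideal.subset_span ⟨i, rfl⟩), lt_of_le_of_ne hQx ?_⟩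
  rintro rfl
  -- Krull's height theorem: if the minimal prime were the maximal ideal of `x`, its height would
  -- exceed the number of equations.
  have h1 := Ideal.height_le_card_of_mem_minimalPrimes_span (Set.finite_range f) hQ
  rw [height_vanishingIdeal_singleton] at h1
  have h2 : (Set.range f).ncard ≤ Nat.card ι := by
    rw [← Set.image_univ, ← Set.ncard_univ]
    exact Set.ncard_image_le
  have h3 : Nat.card σ ≤ (Set.range f).ncard := by exact_mod_cast h1
  omega

theorem exists_ne_mem_zeroLocus {Q : Ideal (MvPolynomial σ k)} [Q.IsPrime] {x : σ → k}
    (h : Q < vanishingIdeal k {x}) : ∃ y ∈ zeroLocus k Q, y ≠ x := by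
  by_contra! hy
  refine h.not_ge ?_
  rw [← IsPrime.vanishingIdeal_zeroLocus (K := k) Q]
  exact vanishingIdeal_anti_mono fun y hyQ => hy y hyQ

end Krull

/-! ### Restriction of a form to a parametrised line. -/

section Line

variable {k : Type*} [Field k] {ι : Type*} {K : Type*} [Field K] [Algebra k K]

open Polynomial in
/-- The restriction of `F` to the line through `p` in direction `q`. -/
noncomputable def lineRestrict (F : MvPolynomial ι k) (p q : ι → K) : K[X] :=
  MvPolynomial.aeval (fun i => C (p i) + C (q i) * X) F

theorem eval_lineRestrict (F : MvPolynomial ι k) (p q : ι → K) (t : K) :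
    (lineRestrict F p q).eval t = MvPolynomial.aeval (p + t • q) F := by
  have : ((Polynomial.aeval t).restrictScalars k).comp
      (MvPolynomial.aeval (fun i => Polynomial.C (p i) + Polynomial.C (q i) * Polynomial.X)) =
      MvPolynomial.aeval (R := k) (p + t • q) := by
    ext i; simp only [AlgHom.comp_apply, MvPolynomial.aeval_X, AlgHom.restrictScalars_apply,
      Polynomial.coe_aeval_eq_eval, Polynomial.eval_add, Polynomial.eval_C, Polynomial.eval_mul,
      Polynomial.eval_X, Pi.add_apply, Pi.smul_apply, smul_eq_mul, mul_comm]
  have h := DFunLike.congr_fun this F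
  simpa [Polynomial.coe_aeval_eq_eval, lineRestrict] using h

/-- The coefficient in degree `d` records the value at `q`, the point at infinity of the
parametrisation `p + t • q`. -/
theorem natDegree_lineRestrict_le {F : MvPolynomial ι k} {d : ℕ} (hF : F.IsHomogeneous d)
    (p q : ι → K) : (lineRestrict F p q).natDegree ≤ d ∧
      (lineRestrict F p q).coeff d = MvPolynomial.aeval q F := by
  have hl : ∀ i, (Polynomial.C (p i) + Polynomial.C (q i) * Polynomial.X).natDegree ≤ 1 := by
    intro i
    rw [add_comm]
    exact Polynomial.natDegree_linear_le
  have hm : ∀ m : ι →₀ ℕ, ∀ s : Finset ι,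
      (∏ i ∈ s, (Polynomial.C (p i) + Polynomial.C (q i) * Polynomial.X) ^ m i).natDegree
        ≤ ∑ i ∈ s, m i ∧
      (∏ i ∈ s, (Polynomial.C (p i) + Polynomial.C (q i) * Polynomial.X) ^ m i).coeff
        (∑ i ∈ s, m i) = ∏ i ∈ s, q i ^ m i := by
    intro m s
    classical
    induction s using Finset.induction_on with
    | empty => simp
    | insert i s hi ih =>
      rw [Finset.prod_insert hi, Finset.sum_insert hi, Finset.prod_insert hi]
      have h1 : ((Polynomial.C (p i) + Polynomial.C (q i) * Polynomial.X) ^ m i).natDegree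
          ≤ m i := by
        simpa using Polynomial.natDegree_pow_le_of_le (m i) (hl i)
      refine ⟨Polynomial.natDegree_mul_le_of_le h1 ih.1, ?_⟩
      rw [Polynomial.coeff_mul_add_eq_of_natDegree_le h1 ih.1, ih.2]
      congr 1
      have := Polynomial.coeff_pow_of_natDegree_le (hl i) (m := m i)
      simpa using this
  have e1 : lineRestrict F p q = ∑ m ∈ F.support, algebraMap k (Polynomial K) (F.coeff m) *
      ∏ i ∈ m.support, (Polynomial.C (p i) + Polynomial.C (q i) * Polynomial.X) ^ m i := by
    rw [lineRestrict, MvPolynomial.aeval_def, MvPolynomial.eval₂_eq]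
  have e2 : MvPolynomial.aeval q F = ∑ m ∈ F.support, algebraMap k K (F.coeff m) *
      ∏ i ∈ m.support, q i ^ m i := by
    rw [MvPolynomial.aeval_def, MvPolynomial.eval₂_eq]
  have hd : ∀ m ∈ F.support, ∑ i ∈ m.support, m i = d := by
    intro m hmF
    have := hF (MvPolynomial.mem_support_iff.mp hmF)
    simpa [Finsupp.weight_apply, Finsupp.sum] using this
  constructor
  · rw [e1]
    refine Polynomial.natDegree_sum_le_of_forall_le _ _ fun m hmF => ?_
    rw [IsScalarTower.algebraMap_apply k K (Polynomial K), Polynomial.algebraMap_eq]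
    refine (Polynomial.natDegree_C_mul_le _ _).trans ?_
    exact (hm m _).1.trans (hd m hmF).le
  · rw [e1, e2, Polynomial.finsetSum_coeff]
    refine Finset.sum_congr rfl fun m hmF => ?_
    rw [IsScalarTower.algebraMap_apply k K (Polynomial K), Polynomial.algebraMap_eq,
      Polynomial.coeff_C_mul, ← hd m hmF, (hm m _).2]

theorem IsHomogeneous.aeval_smul {F : MvPolynomial ι k} {d : ℕ} (hF : F.IsHomogeneous d)
    (c : K) (x : ι → K) :
    MvPolynomial.aeval (c • x) F = c ^ d * MvPolynomial.aeval x F := by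
  simp only [MvPolynomial.aeval_def, MvPolynomial.eval₂_eq, Finset.mul_sum]
  refine Finset.sum_congr rfl fun m hmF => ?_
  have := hF (MvPolynomial.mem_support_iff.mp hmF)
  have hd : ∑ i ∈ m.support, m i = d := by
    simpa [Finsupp.weight_apply, Finsupp.sum] using this
  simp only [Pi.smul_apply, smul_eq_mul, mul_pow, Finset.prod_mul_distrib,
    Finset.prod_pow_eq_pow_sum, hd]
  ring

theorem aeval_span_pair_eq_zero {F : MvPolynomial ι k} {d : ℕ} (hF : F.IsHomogeneous d)
    {p q : ι → K} (h : lineRestrict F p q = 0) (s t : K) :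
    MvPolynomial.aeval (s • p + t • q) F = 0 := by
  by_cases hs : s = 0
  · have h2 := (natDegree_lineRestrict_le hF p q).2
    rw [h] at h2
    rw [hs, zero_smul, zero_add, IsHomogeneous.aeval_smul hF, ← h2]
    simp
  · have h2 := eval_lineRestrict F p q (s⁻¹ * t)
    rw [h, Polynomial.eval_zero] at h2
    have e : s • p + t • q = s • (p + (s⁻¹ * t) • q) := by
      rw [smul_add, smul_smul, mul_inv_cancel_left₀ hs]
    rw [e, IsHomogeneous.aeval_smul hF, ← h2, mul_zero]

theorem lineRestrict_eq_zero_of_natCast [CharZero K] {F : MvPolynomial ι k} {d : ℕ}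
    (hF : F.IsHomogeneous d) {p q : ι → K}
    (h : ∀ n : Fin (d + 1), MvPolynomial.aeval (p + ((n : ℕ) : K) • q) F = 0) :
    lineRestrict F p q = 0 := by
  refine Polynomial.eq_zero_of_natDegree_lt_card_of_eval_eq_zero (lineRestrict F p q)
    (f := fun n : Fin (d + 1) => ((n : ℕ) : K)) ?_ ?_ ?_
  · exact fun a b hab => Fin.ext (Nat.cast_injective hab)
  · intro n
    rw [eval_lineRestrict, h n]
  · simpa using Nat.lt_succ_of_le (natDegree_lineRestrict_le hF p q).1

end Line

/-! ### Chain rule for derivations. -/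

section ChainRule

variable {k : Type*} [CommRing k] {ι : Type*} [Fintype ι] {A : Type*} [CommRing A] [Algebra k A]

theorem derivation_aeval (D : Derivation k A A) (x : ι → A) (F : MvPolynomial ι k) :
    D (MvPolynomial.aeval x F) =
      ∑ i, D (x i) * MvPolynomial.aeval x (MvPolynomial.pderiv i F) := by
  classical
  induction F using MvPolynomial.induction_on with
  | C c => simp
  | add f g hf hg => simp [hf, hg, mul_add, Finset.sum_add_distrib]
  | mul_X f j hf =>
    have e : ∀ i, D (x i) * MvPolynomial.aeval x (MvPolynomial.pderiv i (f * MvPolynomial.X j)) =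
        (if i = j then D (x j) * MvPolynomial.aeval x f else 0) +
          x j * (D (x i) * MvPolynomial.aeval x (MvPolynomial.pderiv i f)) := by
      intro i
      rw [Derivation.leibniz, MvPolynomial.pderiv_X]
      by_cases h : i = j
      · subst h; simp; ring
      · simp [h, Ne.symm h]; ring
    rw [Finset.sum_congr rfl fun i _ => e i, Finset.sum_add_distrib, ← Finset.mul_sum, ← hf]
    simp [mul_comm, add_comm]

end ChainRule

/-! ### Derivations of function fields in characteristic zero. -/

section Derivations

theorem exists_algebraMap_eq_of_isAlgebraic {k : Type*} [Field k] [IsAlgClosed k] {A : Type*}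
    [CommRing A] [IsDomain A] [Algebra k A] {x : A} (hx : IsAlgebraic k x) :
    ∃ c : k, algebraMap k A c = x :=
  minpoly.mem_range_of_degree_eq_one k x
    (IsAlgClosed.degree_eq_one_of_irreducible k (minpoly.irreducible hx.isIntegral))

variable {k : Type*} [Field k] [CharZero k] {K : Type*} [Field K] [Algebra k K]

/-- `K` is algebraic, hence separable, over the rational function field in `x`, and so formally
étale over the polynomial ring. The differentials of `K` are therefore the base change of those of
the polynomial ring, on which a derivation may be prescribed freely. -/
theorem exists_derivation_of_isTranscendenceBasis {ι : Type*} {x : ι → K}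
    (hx : IsTranscendenceBasis k x) (f : ι → K) :
    ∃ D : Derivation k K K, ∀ i, D (x i) = f i := by
  let : Algebra (MvPolynomial ι k) K := (MvPolynomial.aeval x).toAlgebra
  have : IsScalarTower k (MvPolynomial ι k) K := .of_algebraMap_eq fun r => by
    change _ = MvPolynomial.aeval x (MvPolynomial.C r)
    simp
  have hinj : Function.Injective (algebraMap (MvPolynomial ι k) K) := hx.1
  let L := FractionRing (MvPolynomial ι k)
  have : FaithfulSMul (MvPolynomial ι k) K := (faithfulSMul_iff_algebraMap_injective _ _).mpr hinj
  let : Algebra L K := FractionRing.liftAlgebra _ K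
  have : IsScalarTower (MvPolynomial ι k) L K := FractionRing.isScalarTower_liftAlgebra _ K
  have : Algebra.IsAlgebraic (MvPolynomial ι k) K := by
    have h := hx.isAlgebraic
    refine Algebra.IsAlgebraic.of_ringHom_of_comp_eq (S := Algebra.adjoin k (Set.range x)) (B := K)
      hx.1.aevalEquiv.toRingHom (RingHom.id K) hx.1.aevalEquiv.surjective
      Function.injective_id ?_
    ext r
    · simp [RingHom.algebraMap_toAlgebra]
    · simp [RingHom.algebraMap_toAlgebra]
  have : Algebra.IsAlgebraic L K :=
    (IsFractionRing.comap_isAlgebraic_iff (A := MvPolynomial ι k) (K := L)).mp this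
  have : CharZero L := charZero_of_injective_algebraMap
    (IsFractionRing.injective (MvPolynomial ι k) L)
  have : Algebra.FormallyEtale L K := Algebra.FormallyEtale.of_isSeparable L K
  have : Algebra.FormallyEtale (MvPolynomial ι k) L :=
    Algebra.FormallyEtale.of_isLocalization (nonZeroDivisors (MvPolynomial ι k))
  have : Algebra.FormallyEtale (MvPolynomial ι k) K := Algebra.FormallyEtale.comp _ L K
  let D0 : Derivation k (MvPolynomial ι k) K := MvPolynomial.mkDerivation k f
  let φ : Ω[K⁄k] →ₗ[K] K := (D0.liftKaehlerDifferential.liftBaseChange K) ∘ₗ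
    (KaehlerDifferential.tensorKaehlerEquivOfFormallyEtale k (MvPolynomial ι k) K).symm.toLinearMap
  refine ⟨φ.compDer (KaehlerDifferential.D k K), fun i => ?_⟩
  have hxi : x i = algebraMap (MvPolynomial ι k) K (MvPolynomial.X i) := by
    change _ = MvPolynomial.aeval x (MvPolynomial.X i)
    simp
  change φ (KaehlerDifferential.D k K (x i)) = f i
  simp only [φ, LinearMap.comp_apply, LinearEquiv.coe_coe]
  rw [hxi, KaehlerDifferential.tensorKaehlerEquivOfFormallyEtale_symm_D_algebraMap]
  simp [D0]

theorem exists_derivation_of_algebraicIndependent {ι : Type*} {x : ι → K}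
    (hx : AlgebraicIndependent k x) (f : ι → K) :
    ∃ D : Derivation k K K, ∀ i, D (x i) = f i := by
  have hinj : Function.Injective x := AlgebraicIndependent.injective hx
  obtain ⟨t, ht, hbt⟩ :=
    exists_isTranscendenceBasis_superset (AlgebraicIndependent.to_subtype_range hx)
  classical
  let g : t → K := fun y => if h : ∃ i, x i = (y : K) then f h.choose else 0
  obtain ⟨D, hD⟩ := exists_derivation_of_isTranscendenceBasis hbt g
  refine ⟨D, fun i => ?_⟩
  have h := hD ⟨x i, ht ⟨i, rfl⟩⟩
  have hex : ∃ j, x j = x i := ⟨i, rfl⟩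
  have hj : hex.choose = i := hinj hex.choose_spec
  simp only [g] at h
  rw [dif_pos hex, hj] at h
  exact h

/-- On a transcendental element some derivation takes the value 1, and an element algebraic over `k`
already lies in `k`. -/
theorem exists_algebraMap_eq_of_derivation [IsAlgClosed k] (x : K)
    (h : ∀ D : Derivation k K K, D x = 0) : ∃ c : k, algebraMap k K c = x := by
  refine exists_algebraMap_eq_of_isAlgebraic (by_contra fun hx => ?_)
  have hi : AlgebraicIndependent k (fun _ : Unit => x) :=
    algebraicIndependent_unique_type_iff.mpr hx
  obtain ⟨D, hD⟩ := exists_derivation_of_algebraicIndependent hi fun _ => 1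
  have := hD ()
  rw [h D] at this
  exact zero_ne_one this

end Derivations

/-! ### Smooth hypersurfaces contain no plane. -/

section Plane

variable {k : Type*} [Field k]

/-- The affine cone over the hypersurface `F = 0` is smooth outside the origin. -/
def IsSmoothForm {ι : Type*} (F : MvPolynomial ι k) : Prop :=
  ∀ x : ι → k, (∀ i, MvPolynomial.eval x (MvPolynomial.pderiv i F) = 0) → x = 0

theorem sum_mul_eval_pderiv_eq_zero [Infinite k] {ι : Type*} [Fintype ι]
    {F : MvPolynomial ι k} {x v : ι → k}
    (h : ∀ t : k, MvPolynomial.eval (x + t • v) F = 0) :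
    ∑ i, v i * MvPolynomial.eval x (MvPolynomial.pderiv i F) = 0 := by
  have h0 : lineRestrict F x v = 0 := by
    refine Polynomial.funext fun t => ?_
    rw [eval_lineRestrict, Polynomial.eval_zero]
    simpa [MvPolynomial.coe_aeval_eq_eval] using h t
  have h1 := derivation_aeval (Polynomial.derivative' (R := k))
    (fun i => Polynomial.C (x i) + Polynomial.C (v i) * Polynomial.X) F
  rw [lineRestrict] at h0
  rw [h0, map_zero] at h1
  have h2 := congrArg (Polynomial.eval 0) h1
  rw [Polynomial.eval_zero, Polynomial.eval_finsetSum] at h2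
  rw [h2]
  refine Finset.sum_congr rfl fun i _ => ?_
  rw [Polynomial.eval_mul]
  have h3 := eval_lineRestrict (MvPolynomial.pderiv i F) x v (0 : k)
  rw [lineRestrict] at h3
  rw [h3]
  simp [aeval_eq_eval_self]

/-- A smooth hypersurface in `ℙ⁴` of degree at least two contains no plane. -/
theorem not_forall_eval_span_triple_eq_zero [IsAlgClosed k] {ι : Type*} [Fintype ι]
    (hι : Fintype.card ι = 5) {F : MvPolynomial ι k} {d : ℕ} (hd : 2 ≤ d) (hF : F.IsHomogeneous d)
    (hs : IsSmoothForm F) {P : Fin 3 → ι → k} (hP : LinearIndependent k P)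
    (h : ∀ y : Fin 3 → k, MvPolynomial.eval (∑ j, y j • P j) F = 0) : False := by
  have : Infinite k := IsAlgClosed.instInfinite
  obtain ⟨W, hW⟩ := Submodule.exists_isCompl (Submodule.span k (Set.range P))
  have hr : Module.finrank k W = 2 := by
    have h1 := Submodule.finrank_add_eq_of_isCompl hW
    rw [finrank_span_eq_card hP, Module.finrank_fintype_fun_eq_card, hι, Fintype.card_fin] at h1
    omega
  let w := Module.finBasisOfFinrankEq k W hr
  let G : ι → MvPolynomial (Fin 3) k := fun i =>
    MvPolynomial.aeval (fun i => ∑ j, MvPolynomial.C (P j i) * MvPolynomial.X j)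
      (MvPolynomial.pderiv i F)
  have hG : ∀ y i, MvPolynomial.eval y (G i) =
      MvPolynomial.eval (∑ j, y j • P j) (MvPolynomial.pderiv i F) := by
    intro y i
    have : (MvPolynomial.aeval (R := k) y).comp (MvPolynomial.aeval
        (fun i => ∑ j, MvPolynomial.C (P j i) * MvPolynomial.X j)) =
        MvPolynomial.aeval (R := k) (∑ j, y j • P j) := by
      ext i
      simp [mul_comm]
    have h2 := DFunLike.congr_fun this (MvPolynomial.pderiv i F)
    simpa [MvPolynomial.coe_aeval_eq_eval, G] using h2
  let f : Fin 2 → MvPolynomial (Fin 3) k := fun l => ∑ i, MvPolynomial.C ((w l : ι → k) i) * G i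
  have hf : ∀ y l, MvPolynomial.eval y (f l) =
      ∑ i, (w l : ι → k) i * MvPolynomial.eval (∑ j, y j • P j) (MvPolynomial.pderiv i F) := by
    intro y l
    simp [f, hG]
  -- The derivatives along a complement of the plane are two forms of degree `d - 1 ≥ 1` in three
  -- variables. They vanish at the origin, so they have a common zero elsewhere; derivatives along
  -- the plane vanish anyway.
  obtain ⟨Q, hQ, hfQ, hlt⟩ := exists_isPrime_lt_vanishingIdeal (σ := Fin 3) (ι := Fin 2)
    (by simp) f 0 (by
      intro l
      rw [hf]
      refine Finset.sum_eq_zero fun i _ => ?_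
      have h1 : (MvPolynomial.pderiv i F).IsHomogeneous (d - 1) := hF.pderiv
      have h2 := IsHomogeneous.aeval_smul (K := k) h1 0 0
      simp only [aeval_eq_eval_self, smul_zero] at h2
      simp only [Pi.zero_apply, zero_smul, Finset.sum_const_zero]
      rw [h2, zero_pow (by omega), zero_mul, mul_zero])
  obtain ⟨y, hyQ, hy0⟩ := exists_ne_mem_zeroLocus hlt
  set x : ι → k := ∑ j, y j • P j with hx
  have hx0 : x ≠ 0 := fun h0 => hy0 (funext fun j =>
    Fintype.linearIndependent_iff.mp hP y (hx.symm.trans h0) j)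
  let φ : (ι → k) →ₗ[k] k :=
    ∑ i, (MvPolynomial.eval x (MvPolynomial.pderiv i F)) • LinearMap.proj i
  have hφ : ∀ v, φ v = ∑ i, v i * MvPolynomial.eval x (MvPolynomial.pderiv i F) := by
    intro v
    simp [φ, mul_comm]
  have h1 : Submodule.span k (Set.range P) ≤ LinearMap.ker φ := by
    rw [Submodule.span_le]
    rintro _ ⟨j, rfl⟩
    simp only [SetLike.mem_coe, LinearMap.mem_ker, hφ]
    refine sum_mul_eval_pderiv_eq_zero fun t => ?_
    have := h (y + Pi.single j t)
    rw [← this]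
    congr 2
    simp [add_smul, Finset.sum_add_distrib, hx, Pi.single_apply, ite_smul]
  have h2 : W ≤ LinearMap.ker φ := by
    have e : W = Submodule.span k (Set.range (W.subtype ∘ w)) := by
      rw [Set.range_comp, ← Submodule.map_span, w.span_eq, Submodule.map_top,
        Submodule.range_subtype]
    rw [e, Submodule.span_le]
    rintro _ ⟨l, rfl⟩
    have := hyQ (f l) (hfQ l)
    rw [aeval_eq_eval_self, hf] at this
    simpa [hφ] using this
  have h3 : LinearMap.ker φ = ⊤ := top_le_iff.mp (hW.sup_eq_top ▸ sup_le h1 h2)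
  refine hx0 (hs x fun i => ?_)
  classical
  have : φ (Pi.single i 1) = 0 := by
    rw [← LinearMap.mem_ker, h3]
    trivial
  simpa [hφ, Pi.single_apply] using this

end Plane

/-! ### Syzygies between the partial derivatives along a line. -/

section UpperBound

open Polynomial

theorem eq_zero_of_forall_eval_algebraMap {k K : Type*} [Field k] [Infinite k] [Field K]
    [Algebra k K] {f : K[X]} (h : ∀ t : k, f.eval (algebraMap k K t) = 0) : f = 0 :=
  eq_zero_of_infinite_isRoot f <| (Set.infinite_range_of_injective
    (algebraMap k K).injective).mono (by rintro _ ⟨t, rfl⟩; exact h t)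

/-- Linear syzygies of three coprime binary cubics (in an affine coordinate, with the behaviour at
infinity expressed by the leading coefficient) are proportional. -/
theorem linear_syzygies_proportional {K : Type*} [Field K] {G l m r : Fin 3 → K[X]}
    (hr : ∑ j, r j * G j = 1) (hG : ∃ j, (G j).coeff 3 ≠ 0)
    (hl : ∀ j, (l j).natDegree ≤ 1) (hm : ∀ j, (m j).natDegree ≤ 1)
    (hlG : ∑ j, l j * G j = 0) (hmG : ∑ j, m j * G j = 0) (i j : Fin 3) :
    l i * m j = l j * m i := by
  obtain ⟨n, hn⟩ := hG
  rw [Fin.sum_univ_three] at hr hlG hmG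
  have hdeg : ∀ i j, (l i * m j - l j * m i).natDegree ≤ 2 := fun i j =>
    natDegree_sub_le_of_le (natDegree_mul_le_of_le (hl i) (hm j))
      (natDegree_mul_le_of_le (hl j) (hm i))
  -- Both syzygies annihilate `G`, so their cross product is a multiple of `G`; pairing it with the
  -- Bézout vector `r` identifies the multiplier.
  set s := r 0 * (l 1 * m 2 - l 2 * m 1) + r 1 * (l 2 * m 0 - l 0 * m 2) +
    r 2 * (l 0 * m 1 - l 1 * m 0) with hs
  have h0 : l 1 * m 2 - l 2 * m 1 = G 0 * s := by
    rw [hs]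
    linear_combination (-(l 1 * m 2 - l 2 * m 1)) * hr + (r 1 * m 2 - r 2 * m 1) * hlG -
      (r 1 * l 2 - r 2 * l 1) * hmG
  have h1 : l 2 * m 0 - l 0 * m 2 = G 1 * s := by
    rw [hs]
    linear_combination (-(l 2 * m 0 - l 0 * m 2)) * hr + (r 2 * m 0 - r 0 * m 2) * hlG -
      (r 2 * l 0 - r 0 * l 2) * hmG
  have h2 : l 0 * m 1 - l 1 * m 0 = G 2 * s := by
    rw [hs]
    linear_combination (-(l 0 * m 1 - l 1 * m 0)) * hr + (r 0 * m 1 - r 1 * m 0) * hlG -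
      (r 0 * l 1 - r 1 * l 0) * hmG
  -- The cross product has degree at most 2, while some entry of `G` has degree at least 3.
  have hs0 : s = 0 := by
    by_contra hs0
    have hGn : G n ≠ 0 := fun h => hn (by rw [h, coeff_zero])
    have h3 : 3 ≤ (G n).natDegree := le_natDegree_of_ne_zero hn
    have h4 : (G n * s).natDegree ≤ 2 := by
      fin_cases n
      · exact h0 ▸ hdeg 1 2
      · exact h1 ▸ hdeg 2 0
      · exact h2 ▸ hdeg 0 1
    rw [natDegree_mul hGn hs0] at h4
    omega
  rw [hs0, mul_zero] at h0 h1 h2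
  fin_cases i <;> fin_cases j <;> simp only [Fin.zero_eta, Fin.mk_one, Fin.reduceFinMk] <;>
    first
    | rfl
    | linear_combination h0
    | linear_combination h1
    | linear_combination h2
    | linear_combination -h0
    | linear_combination -h1
    | linear_combination -h2

variable {k : Type*} [Field k] {ι : Type*} [Fintype ι] {K : Type*} [Field K] [Algebra k K]

theorem exists_X_pow_eq_sum_pderiv [IsAlgClosed k] {F : MvPolynomial ι k} (hs : IsSmoothForm F)
    (i₀ : ι) : ∃ (N : ℕ) (h : ι → MvPolynomial ι k),
      ∑ i, h i * MvPolynomial.pderiv i F = MvPolynomial.X i₀ ^ N := by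
  set I := Ideal.span (Set.range fun i => MvPolynomial.pderiv i F) with hI
  have h1 : MvPolynomial.X i₀ ∈ I.radical := by
    rw [← MvPolynomial.vanishingIdeal_zeroLocus_eq_radical (K := k)]
    intro x hx
    have : x = 0 := hs x fun i => by
      have := hx (MvPolynomial.pderiv i F) (Ideal.subset_span ⟨i, rfl⟩)
      rwa [aeval_eq_eval_self] at this
    simp [this]
  obtain ⟨N, hN⟩ := h1
  obtain ⟨c, hc⟩ := (Ideal.mem_span_range_iff_exists_fun).mp hN
  exact ⟨N, c, hc⟩

/-- Differentiating along the line gives the relation with `q`; Euler's identity then gives the one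
with `p`. -/
theorem sum_C_mul_lineRestrict_pderiv {F : MvPolynomial ι k} {d : ℕ} (hF : F.IsHomogeneous d)
    {p q : ι → K} (h : lineRestrict F p q = 0) :
    ∑ i, C (p i) * lineRestrict (MvPolynomial.pderiv i F) p q = 0 ∧
    ∑ i, C (q i) * lineRestrict (MvPolynomial.pderiv i F) p q = 0 := by
  have hq : ∑ i, C (q i) * lineRestrict (MvPolynomial.pderiv i F) p q = 0 := by
    have h1 := derivation_aeval ((Polynomial.derivative' (R := K)).restrictScalars k)
      (fun i => C (p i) + C (q i) * X) F
    rw [← lineRestrict, h, map_zero] at h1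
    rw [h1]
    refine Finset.sum_congr rfl fun i _ => ?_
    simp [lineRestrict, Derivation.restrictScalars_apply]
  refine ⟨?_, hq⟩
  have h2 := congrArg (MvPolynomial.aeval fun i => C (p i) + C (q i) * X) hF.sum_X_mul_pderiv
  rw [map_nsmul, ← lineRestrict.eq_def F, h, smul_zero, map_sum] at h2
  have h3 : ∑ i, C (p i) * lineRestrict (MvPolynomial.pderiv i F) p q +
      X * ∑ i, C (q i) * lineRestrict (MvPolynomial.pderiv i F) p q = 0 := by
    rw [← h2, Finset.mul_sum, ← Finset.sum_add_distrib]
    refine Finset.sum_congr rfl fun i _ => ?_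
    rw [map_mul, MvPolynomial.aeval_X, lineRestrict]
    ring
  rwa [hq, mul_zero, add_zero] at h3

theorem sum_derivation_mul_lineRestrict_pderiv [Infinite k] {F : MvPolynomial ι k}
    {p q : ι → K} (h : lineRestrict F p q = 0) (D : Derivation k K K) :
    ∑ i, (C (D (p i)) + C (D (q i)) * X) * lineRestrict (MvPolynomial.pderiv i F) p q = 0 := by
  -- For a parameter `t` in `k`, which `D` kills, apply `D` to the vanishing of `F` at `p + t • q`;
  -- infinitely many `t` suffice.
  refine eq_zero_of_forall_eval_algebraMap (k := k) fun t => ?_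
  have h1 := derivation_aeval D (p + algebraMap k K t • q) F
  rw [← eval_lineRestrict, h, eval_zero, map_zero] at h1
  rw [h1, eval_finsetSum]
  refine Finset.sum_congr rfl fun i _ => ?_
  rw [eval_mul, eval_lineRestrict]
  congr 1
  simp only [Pi.add_apply, Pi.smul_apply, smul_eq_mul, map_add, Derivation.leibniz,
    Derivation.map_algebraMap, eval_add, eval_mul, eval_C, eval_X]
  ring

end UpperBound

/-! ### Two-dimensional families of lines sweep out a plane. -/

section NormalForm

open Polynomial

variable {k : Type*} [Field k] [IsAlgClosed k] {K : Type*} [Field K] [Algebra k K]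
  {F : MvPolynomial (Fin 2 ⊕ Fin 3) k} {a b : Fin 3 → K}

/-- The point `(1 : 0 : a)`, one of the two spanning the line with affine coordinates `(a, b)`. -/
abbrev lineFst (a : Fin 3 → K) : Fin 2 ⊕ Fin 3 → K := Sum.elim ![1, 0] a

/-- The point `(0 : 1 : b)`, one of the two spanning the line with affine coordinates `(a, b)`. -/
abbrev lineSnd (b : Fin 3 → K) : Fin 2 ⊕ Fin 3 → K := Sum.elim ![0, 1] b

/-- `D` and `E` each give a linear syzygy between the three partials in the `inr` directions; the
other two partials are combinations of these. The relations are the coefficients of `1`, `X ^ 2` and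
`X` in the proportionality of the two syzygies. -/
theorem derivation_syzygies_proportional (hF : F.IsHomogeneous 4) (hs : IsSmoothForm F)
    (hline : lineRestrict F (lineFst a) (lineSnd b) = 0) (D E : Derivation k K K) (i j : Fin 3) :
    D (a i) * E (a j) = D (a j) * E (a i) ∧ D (b i) * E (b j) = D (b j) * E (b i) ∧
      D (a i) * E (b j) + D (b i) * E (a j) = D (a j) * E (b i) + D (b j) * E (a i) := by
  have : Infinite k := IsAlgClosed.instInfinite
  set G : Fin 2 ⊕ Fin 3 → K[X] := fun i =>
    lineRestrict (MvPolynomial.pderiv i F) (lineFst a) (lineSnd b) with hG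
  have hdeg : ∀ i, (G i).coeff 3 = MvPolynomial.aeval (lineSnd b) (MvPolynomial.pderiv i F) :=
    fun i => (natDegree_lineRestrict_le (d := 3) (hF.pderiv (i := i)) _ _).2
  obtain ⟨h0, h1⟩ := sum_C_mul_lineRestrict_pderiv hF hline
  have h0' : G (Sum.inl 0) = -∑ j, C (a j) * G (Sum.inr j) := by
    rw [eq_neg_iff_add_eq_zero, ← h0]
    simp [Fintype.sum_sum_type, hG]
  have h1' : G (Sum.inl 1) = -∑ j, C (b j) * G (Sum.inr j) := by
    rw [eq_neg_iff_add_eq_zero, ← h1]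
    simp [Fintype.sum_sum_type, hG]
  have hbez : ∃ r : Fin 3 → K[X], ∑ j, r j * G (Sum.inr j) = 1 := by
    -- The coordinate `inl 0` is identically 1 on the parametrised line, so this relation restricts
    -- to a Bézout identity.
    obtain ⟨N, h, hN⟩ := exists_X_pow_eq_sum_pderiv hs (Sum.inl 0)
    have h2 := congrArg (MvPolynomial.aeval fun i => C (lineFst a i) + C (lineSnd b i) * X) hN
    simp only [map_sum, map_mul, map_pow, MvPolynomial.aeval_X] at h2
    set H : Fin 2 ⊕ Fin 3 → K[X] := fun i => lineRestrict (h i) (lineFst a) (lineSnd b) with hH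
    have h3 : ∑ i, H i * G i = 1 := by
      rw [show (1 : K[X]) = (C (lineFst a (Sum.inl 0)) + C (lineSnd b (Sum.inl 0)) * X) ^ N by simp,
        ← h2]
      rfl
    refine ⟨fun j => H (Sum.inr j) - H (Sum.inl 0) * C (a j) - H (Sum.inl 1) * C (b j), ?_⟩
    rw [← h3, Fintype.sum_sum_type, Fin.sum_univ_two, h0', h1']
    simp only [Fin.sum_univ_three]
    ring
  have hlead : ∃ j, (G (Sum.inr j)).coeff 3 ≠ 0 := by
    by_contra! hc
    have hall : ∀ i, (G i).coeff 3 = 0 := by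
      rintro (i | j)
      · fin_cases i
        · change (G (Sum.inl 0)).coeff 3 = 0
          rw [h0', coeff_neg, finsetSum_coeff]
          simp [coeff_C_mul, hc]
        · change (G (Sum.inl 1)).coeff 3 = 0
          rw [h1', coeff_neg, finsetSum_coeff]
          simp [coeff_C_mul, hc]
      · exact hc j
    -- At the point at infinity the coordinate `inl 1` is 1, so the partials cannot all vanish
    -- there.
    obtain ⟨N, h, hN⟩ := exists_X_pow_eq_sum_pderiv hs (Sum.inl 1)
    have h2 := congrArg (MvPolynomial.aeval (lineSnd b)) hN
    simp only [map_sum, map_mul, map_pow, MvPolynomial.aeval_X, ← hdeg, hall] at h2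
    simp at h2
  obtain ⟨r, hr⟩ := hbez
  have hsyz : ∀ D : Derivation k K K,
      ∑ j, (C (D (a j)) + C (D (b j)) * X) * G (Sum.inr j) = 0 := by
    intro D
    have h2 := sum_derivation_mul_lineRestrict_pderiv hline D
    rw [Fintype.sum_sum_type] at h2
    simpa [hG] using h2
  have hl : ∀ (D : Derivation k K K) j, (C (D (a j)) + C (D (b j)) * X).natDegree ≤ 1 := by
    intro D j
    rw [add_comm]
    exact natDegree_linear_le
  have key := linear_syzygies_proportional hr hlead (hl D) (hl E) (hsyz D) (hsyz E) i j
  have e : ∀ x y z w : K, (C x + C y * X) * (C z + C w * X) =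
      C (x * z) + C (x * w + y * z) * X + C (y * w) * X ^ 2 := by
    intro x y z w
    simp only [C_mul, C_add]
    ring
  rw [e, e] at key
  have hc := fun n => congrArg (fun f => coeff f n) key
  simp only [coeff_add, coeff_C_mul, coeff_X, coeff_C, coeff_X_pow] at hc
  exact ⟨by simpa using hc 0, by simpa using hc 2, by simpa using hc 1⟩

/-- All infinitesimal deformations of the generic line of a family of dimension at least two move
it in one fixed direction `c`. -/
theorem exists_common_direction (hF : F.IsHomogeneous 4) (hs : IsSmoothForm F)
    (hline : lineRestrict F (lineFst a) (lineSnd b) = 0)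
    (hgen : ∀ D : Derivation k K K, (∀ j, D (a j) = 0) → (∀ j, D (b j) = 0) → D = 0)
    {D₁ D₂ : Derivation k K K} (hD : ∀ x y : K, x • D₁ + y • D₂ = 0 → x = 0 ∧ y = 0) :
    ∃ (n : Fin 3) (c : Fin 3 → K), c n = 1 ∧ ∀ (E : Derivation k K K) (j : Fin 3),
      E (a j) = c j * E (a n) ∧ E (b j) = c j * E (b n) := by
  have hsyz := derivation_syzygies_proportional hF hs hline
  -- If a minor were nonzero, the `a`-parts and the `b`-parts of `D₂` and `D₁` would be
  -- proportional, the mixed relation would equate the two ratios, and `D₂` would be a multiple of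
  -- `D₁`.
  have hrank : ∀ i j, D₁ (a i) * D₁ (b j) = D₁ (a j) * D₁ (b i) := by
    intro i j
    by_contra hne
    have hex : ∃ x : K, ∀ l, D₂ (a l) = x * D₁ (a l) ∧ D₂ (b l) = x * D₁ (b l) := by
      have ha : ∃ x, ∀ l, D₂ (a l) = x * D₁ (a l) := by
        obtain ⟨n, hn⟩ : ∃ n, D₁ (a n) ≠ 0 := by
          by_contra! hc
          simp [hc] at hne
        refine ⟨D₂ (a n) / D₁ (a n), fun l => ?_⟩
        have := (hsyz D₁ D₂ n l).1
        field_simp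
        linear_combination this
      have hb : ∃ x, ∀ l, D₂ (b l) = x * D₁ (b l) := by
        obtain ⟨n, hn⟩ : ∃ n, D₁ (b n) ≠ 0 := by
          by_contra! hc
          simp [hc] at hne
        refine ⟨D₂ (b n) / D₁ (b n), fun l => ?_⟩
        have := (hsyz D₁ D₂ n l).2.1
        field_simp
        linear_combination this
      obtain ⟨x, hx⟩ := ha
      obtain ⟨y, hy⟩ := hb
      have hxy : y = x := by
        have h3 := (hsyz D₁ D₂ i j).2.2
        rw [hx, hx, hy, hy] at h3
        refine mul_right_cancel₀ (sub_ne_zero.mpr hne) ?_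
        linear_combination h3
      exact ⟨x, fun l => ⟨hx l, hxy ▸ hy l⟩⟩
    obtain ⟨x, hx⟩ := hex
    have := hD x (-1) (hgen _ (fun l => by simp [(hx l).1]) (fun l => by simp [(hx l).2]))
    simpa using this.2
  have hne : ∃ n, D₁ (a n) ≠ 0 ∨ D₁ (b n) ≠ 0 := by
    by_contra! hc
    have := hD 1 0 (by
      rw [hgen D₁ (fun j => (hc j).1) (fun j => (hc j).2)]; simp)
    exact one_ne_zero this.1
  obtain ⟨n, hn⟩ := hne
  by_cases ha : D₁ (a n) = 0
  · have hb : D₁ (b n) ≠ 0 := by tauto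
    have ha' : ∀ j, D₁ (a j) = 0 := fun j => by
      have := hrank n j
      rw [ha, zero_mul] at this
      exact (mul_eq_zero.mp this.symm).resolve_right hb
    refine ⟨n, fun j => D₁ (b j) / D₁ (b n), div_self hb, fun E j => ⟨?_, ?_⟩⟩
    · have := (hsyz D₁ E n j).2.2
      rw [ha, ha' j] at this
      field_simp
      linear_combination this
    · have := (hsyz D₁ E n j).2.1
      field_simp
      linear_combination this
  · have h1 : ∀ (E : Derivation k K K) j, E (a j) = D₁ (a j) / D₁ (a n) * E (a n) := by
      intro E j
      have := (hsyz D₁ E n j).1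
      field_simp
      linear_combination this
    refine ⟨n, fun j => D₁ (a j) / D₁ (a n), div_self ha, fun E j => ⟨h1 E j, ?_⟩⟩
    have h2 := (hsyz D₁ E n j).2.2
    have h3 := hrank n j
    have h4 := (hsyz D₁ E n j).1
    field_simp
    refine mul_left_cancel₀ ha ?_
    linear_combination D₁ (a n) * h2 - D₁ (b n) * h4 + E (a n) * h3

/-- A smooth quartic threefold carries no family of lines of dimension at least two. -/
theorem not_exists_independent_derivations [CharZero k] (hF : F.IsHomogeneous 4)
    (hs : IsSmoothForm F) (hline : lineRestrict F (lineFst a) (lineSnd b) = 0)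
    (hgen : ∀ D : Derivation k K K, (∀ j, D (a j) = 0) → (∀ j, D (b j) = 0) → D = 0)
    {D₁ D₂ : Derivation k K K} (hD : ∀ x y : K, x • D₁ + y • D₂ = 0 → x = 0 ∧ y = 0) : False := by
  obtain ⟨n, c, hcn, hc⟩ := exists_common_direction hF hs hline hgen hD
  have hgen' : ∀ E : Derivation k K K, E (a n) = 0 → E (b n) = 0 → E = 0 := fun E h1 h2 =>
    hgen E (fun j => by rw [(hc E j).1, h1, mul_zero]) (fun j => by rw [(hc E j).2, h2, mul_zero])
  set u := a n with hu
  set v := b n with hv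
  have hdet : D₁ u * D₂ v - D₂ u * D₁ v ≠ 0 := by
    intro h0
    have h1 := hD (D₂ v) (-D₁ v) (hgen' _ (by simp; linear_combination h0) (by simp; ring))
    have h2 := hD (D₂ u) (-D₁ u) (hgen' _ (by simp; ring) (by simp; linear_combination -h0))
    have h3 := hD 1 0 (by
      rw [hgen' D₁ (neg_eq_zero.mp h2.2) (neg_eq_zero.mp h1.2)]; simp)
    exact one_ne_zero h3.1
  set Δ := D₁ u * D₂ v - D₂ u * D₁ v with hΔ
  -- `U` and `V` play the role of `∂/∂u` and `∂/∂v`, obtained from `D₁` and `D₂` by Cramer's rule.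
  obtain ⟨U, hUu, hUv⟩ : ∃ U : Derivation k K K, U u = 1 ∧ U v = 0 := by
    refine ⟨(Δ⁻¹ * D₂ v) • D₁ - (Δ⁻¹ * D₁ v) • D₂, ?_, ?_⟩
    · simp only [Derivation.sub_apply, Derivation.smul_apply, smul_eq_mul]
      rw [hΔ] at hdet ⊢
      field_simp
    · simp only [Derivation.sub_apply, Derivation.smul_apply, smul_eq_mul]
      ring
  obtain ⟨V, hVu, hVv⟩ : ∃ V : Derivation k K K, V u = 0 ∧ V v = 1 := by
    refine ⟨(Δ⁻¹ * D₁ u) • D₂ - (Δ⁻¹ * D₂ u) • D₁, ?_, ?_⟩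
    · simp only [Derivation.sub_apply, Derivation.smul_apply, smul_eq_mul]
      ring
    · simp only [Derivation.sub_apply, Derivation.smul_apply, smul_eq_mul]
      rw [hΔ] at hdet ⊢
      field_simp
  have hcomm : ∀ x, U (V x) = V (U x) := by
    have h0 : ⁅U, V⁆ = 0 := hgen' _
      (by rw [Derivation.commutator_apply, hVu, hUu]; simp)
      (by rw [Derivation.commutator_apply, hVv, hUv]; simp)
    intro x
    rw [← sub_eq_zero, ← Derivation.commutator_apply, h0, Derivation.zero_apply]
  have hspan : ∀ E : Derivation k K K, E = E u • U + E v • V := by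
    intro E
    refine sub_eq_zero.mp (hgen' _ ?_ ?_)
    · simp [hUu, hVu]
    · simp [hUv, hVv]
  -- Here `c j = V (b j)` while `U (b j) = 0`, so commutation gives the claim; for `V` the same
  -- works with `a j`.
  have hcU : ∀ j, U (c j) = 0 := by
    intro j
    have h1 := hcomm (b j)
    rw [(hc V j).2, (hc U j).2, hVv, hUv, mul_one, mul_zero, map_zero] at h1
    exact h1
  have hcV : ∀ j, V (c j) = 0 := by
    intro j
    have h1 := hcomm (a j)
    rw [(hc V j).1, (hc U j).1, hVu, hUu, mul_one, mul_zero, map_zero] at h1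
    exact h1.symm
  have hcE : ∀ (E : Derivation k K K) j, E (c j) = 0 := by
    intro E j
    rw [hspan E]
    simp [hcU, hcV]
  choose c' hc' using fun j => exists_algebraMap_eq_of_derivation (c j) (fun E => hcE E j)
  choose d' hd' using fun j => exists_algebraMap_eq_of_derivation (k := k) (a j - c j * u)
    (fun E => by
      rw [map_sub, Derivation.leibniz, hcE, (hc E j).1]; simp)
  choose e' he' using fun j => exists_algebraMap_eq_of_derivation (k := k) (b j - c j * v)
    (fun E => by
      rw [map_sub, Derivation.leibniz, hcE, (hc E j).2]; simp)
  have htr : ∀ s t : k, (s ≠ 0 ∨ t ≠ 0) →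
      Transcendental k (algebraMap k K s * u + algebraMap k K t * v) := by
    intro s t hst halg
    obtain ⟨x, hx⟩ := exists_algebraMap_eq_of_isAlgebraic halg
    have h1 := congrArg U hx
    have h2 := congrArg V hx
    simp [hUu, hUv, hVu, hVv] at h1 h2
    exact hst.elim (fun h => h ((map_eq_zero _).mp h1.symm)) fun h => h ((map_eq_zero _).mp h2.symm)
  let P : Fin 3 → Fin 2 ⊕ Fin 3 → k := ![Sum.elim ![1, 0] d', Sum.elim ![0, 1] e', Sum.elim 0 c']
  have hP : LinearIndependent k P := by
    rw [Fintype.linearIndependent_iff]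
    intro g hg
    rw [Fin.sum_univ_three] at hg
    have g0 := congrFun hg (Sum.inl 0)
    have g1 := congrFun hg (Sum.inl 1)
    have g2 := congrFun hg (Sum.inr n)
    have hcn' : c' n = 1 := (algebraMap k K).injective (by rw [hc', hcn, map_one])
    simp [P] at g0 g1
    simp [P, g0, g1, hcn'] at g2
    intro i
    fin_cases i <;> assumption
  have hzero : ∀ s t z : k, (s ≠ 0 ∨ t ≠ 0) →
      MvPolynomial.eval (s • P 0 + t • P 1 + z • P 2) F = 0 := by
    intro s t z hst
    have h1 := aeval_span_pair_eq_zero hF hline (algebraMap k K s) (algebraMap k K t)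
    -- The point of the generic line with parameters `s`, `t` is `s • P 0 + t • P 1 + (s * u + t *
    -- v) • P 2`. Its last coefficient is transcendental over `k`, so a polynomial over `k`
    -- vanishing there is zero.
    have h2 : lineRestrict F (s • P 0 + t • P 1) (P 2) = 0 := by
      refine by_contra fun hne => htr s t hst ⟨_, hne, ?_⟩
      rw [← h1]
      have hcomp : ((Polynomial.aeval (algebraMap k K s * u + algebraMap k K t * v)).comp
          (MvPolynomial.aeval (R := k) fun i => C ((s • P 0 + t • P 1) i) + C (P 2 i) * X)) =
          MvPolynomial.aeval (algebraMap k K s • lineFst a + algebraMap k K t • lineSnd b) := by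
        ext i
        rcases i with i | j
        · fin_cases i <;> simp [P, Algebra.smul_def]
        · have ha : a j = algebraMap k K (d' j) + algebraMap k K (c' j) * u := by
            rw [hd', hc']; ring
          have hb : b j = algebraMap k K (e' j) + algebraMap k K (c' j) * v := by
            rw [he', hc']; ring
          simp [P, ha, hb, Algebra.smul_def]
          ring
      exact DFunLike.congr_fun hcomp F
    have h3 := eval_lineRestrict F (s • P 0 + t • P 1) (P 2) z
    rw [h2, eval_zero, aeval_eq_eval_self] at h3
    exact h3.symm
  have hzero' : ∀ s t z : k, MvPolynomial.eval (s • P 0 + t • P 1 + z • P 2) F = 0 := by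
    intro s t z
    by_cases hst : s ≠ 0 ∨ t ≠ 0
    · exact hzero s t z hst
    · push Not at hst
      -- For `s = t = 0` nothing is transcendental; the point `P 2` is instead reached as the point
      -- at infinity of the line through `P 0` in direction `P 2`.
      have h2 : lineRestrict F (P 0) (P 2) = 0 := by
        have : Infinite k := IsAlgClosed.instInfinite
        refine Polynomial.funext fun z => ?_
        have := hzero 1 0 z (Or.inl one_ne_zero)
        rw [eval_lineRestrict, aeval_eq_eval_self, eval_zero, ← this]
        simp
      have h3 := aeval_span_pair_eq_zero hF h2 0 z
      rw [aeval_eq_eval_self] at h3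
      rw [← h3, hst.1, hst.2]
      simp
  refine not_forall_eval_span_triple_eq_zero (by simp) (by norm_num : 2 ≤ 4) hF hs hP fun y => ?_
  rw [Fin.sum_univ_three]
  exact hzero' _ _ _

end NormalForm

/-! ### Existence of a line by degeneration. -/

section Existence

open MvPolynomial

universe u

variable {k : Type u} [Field k]

/-- A quartic form for which the conditions to contain a line near `x₂ = x₃ = x₄ = 0` are linear. -/
noncomputable def linearizedQuartic (k : Type*) [Field k] : MvPolynomial (Fin 5) k :=
  X 2 * X 0 ^ 3 + X 3 * X 1 ^ 3 + X 4 * X 0 ^ 2 * X 1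

theorem linearizedQuartic_isHomogeneous : (linearizedQuartic k).IsHomogeneous 4 := by
  have hX : ∀ i, (X i : MvPolynomial (Fin 5) k).IsHomogeneous 1 := isHomogeneous_X k
  exact (((hX 2).mul ((hX 0).pow 3)).add ((hX 3).mul ((hX 1).pow 3))).add
    (((hX 4).mul ((hX 0).pow 2)).mul (hX 1))

theorem aeval_linearizedQuartic {A : Type*} [CommRing A] [Algebra k A] (x : Fin 5 → A) :
    aeval x (linearizedQuartic k) = x 2 * x 0 ^ 3 + x 3 * x 1 ^ 3 + x 4 * x 0 ^ 2 * x 1 := by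
  simp [linearizedQuartic]

theorem eq_zero_of_forall_natCast_quartic {K : Type*} [Field K] [CharZero K] (a b c d e : K)
    (h : ∀ n : Fin 5, a + b * ((n : ℕ) : K) + c * ((n : ℕ) : K) ^ 2 + d * ((n : ℕ) : K) ^ 3 +
      e * ((n : ℕ) : K) ^ 4 = 0) : a = 0 ∧ b = 0 ∧ c = 0 ∧ d = 0 ∧ e = 0 := by
  have y0 := h 0
  have y1 := h 1
  have y2 := h 2
  have y3 := h 3
  have y4 := h 4
  norm_num at y0 y1 y2 y3 y4
  refine ⟨y0, ?_, ?_, ?_, ?_⟩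
  · linear_combination (-50 * y0 + 96 * y1 - 72 * y2 + 32 * y3 - 6 * y4) / 24
  · linear_combination (35 * y0 - 104 * y1 + 114 * y2 - 56 * y3 + 11 * y4) / 24
  · linear_combination (-10 * y0 + 36 * y1 - 48 * y2 + 28 * y3 - 6 * y4) / 24
  · linear_combination (y0 - 4 * y1 + 6 * y2 - 4 * y3 + y4) / 24

/-- With `F₀` the linearized quartic, `F₀ + T (F - F₀)` contains a line over some function field in
which `T` is transcendental. -/
theorem exists_line_in_pencil [IsAlgClosed k] [CharZero k] {F : MvPolynomial (Fin 5) k}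
    (hF : F.IsHomogeneous 4) :
    ∃ (K : Type u) (_ : Field K) (_ : Algebra k K) (T : K) (p q : Fin 5 → K),
      Transcendental k T ∧ p 0 * q 1 - p 1 * q 0 = 1 ∧ ∀ s t : K,
        aeval (s • p + t • q) (linearizedQuartic k) +
          T * (aeval (s • p + t • q) F - aeval (s • p + t • q) (linearizedQuartic k)) = 0 := by
  let R := MvPolynomial (Option (Fin 2 × Fin 3)) k
  let p : Fin 5 → R := ![1, 0, X (some (0, 0)), X (some (0, 1)), X (some (0, 2))]
  let q : Fin 5 → R := ![0, 1, X (some (1, 0)), X (some (1, 1)), X (some (1, 2))]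
  -- Six equations in seven unknowns (`T` and six line coordinates). The extra equation kills one
  -- coordinate, so that at `T = 0` the origin is the only solution.
  let f : Option (Fin 5) → R := fun n => n.elim (X (some (0, 2))) fun n =>
    aeval (p + ((n : ℕ) : R) • q) (linearizedQuartic k) + X none *
      (aeval (p + ((n : ℕ) : R) • q) F - aeval (p + ((n : ℕ) : R) • q) (linearizedQuartic k))
  obtain ⟨Q, hQ, hfQ, hlt⟩ := exists_isPrime_lt_vanishingIdeal (by simp) f 0 (by
    rintro (_ | n)
    · simp [f]
    · simp [f, aeval_linearizedQuartic, p, q])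
  let K := FractionRing (R ⧸ Q)
  let φ : R →ₐ[k] K := (IsScalarTower.toAlgHom k (R ⧸ Q) K).comp (Ideal.Quotient.mkₐ k Q)
  have hφ : ∀ g, φ g = 0 ↔ g ∈ Q := by
    intro g
    rw [← Ideal.Quotient.eq_zero_iff_mem, ← (IsFractionRing.injective (R ⧸ Q) K).eq_iff, map_zero]
    rfl
  have : CharZero K := charZero_of_injective_algebraMap (algebraMap k K).injective
  have hcomp : ∀ (x : Fin 5 → R) (G : MvPolynomial (Fin 5) k),
      φ (aeval x G) = aeval (fun i => φ (x i)) G := by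
    intro x G
    rw [← AlgHom.comp_apply, comp_aeval]
  have hn : ∀ n : Fin 5, aeval (φ ∘ p + ((n : ℕ) : K) • φ ∘ q) (linearizedQuartic k) +
      φ (X none) * (aeval (φ ∘ p + ((n : ℕ) : K) • φ ∘ q) F -
        aeval (φ ∘ p + ((n : ℕ) : K) • φ ∘ q) (linearizedQuartic k)) = 0 := by
    intro n
    have h1 := (hφ _).mpr (hfQ (some n))
    simp only [f, Option.elim_some, map_add, map_mul, map_sub, hcomp] at h1
    have e : (fun i => φ ((p + ((n : ℕ) : R) • q) i)) = φ ∘ p + ((n : ℕ) : K) • φ ∘ q := by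
      ext i
      simp
    rwa [e] at h1
  have h2 : φ (X (some (0, 2))) = 0 := (hφ _).mpr (hfQ none)
  refine ⟨K, inferInstance, inferInstance, φ (X none), φ ∘ p, φ ∘ q, ?_, ?_, ?_⟩
  · intro halg
    obtain ⟨c, hc⟩ := exists_algebraMap_eq_of_isAlgebraic halg
    -- A constant value of `T` must be its value at the origin, since `Q` lies in the ideal of the
    -- origin.
    have hc0 : c = 0 := by
      have h1 : X none - C c ∈ Q := by
        rw [← hφ, map_sub, ← hc, sub_eq_zero]
        exact (φ.commutes c).symm
      have h3 := (mem_vanishingIdeal_singleton_iff _ _).mp (hlt.le h1)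
      simpa using h3
    have hT : φ (X none) = 0 := by rw [← hc, hc0, map_zero]
    have hall : ∀ i, φ (X i) = 0 := by
      simp only [hT, zero_mul, add_zero, aeval_linearizedQuartic] at hn
      obtain ⟨h00, h10, h12, h01, h11⟩ := eq_zero_of_forall_natCast_quartic
        (φ (X (some (0, 0)))) (φ (X (some (1, 0)))) (φ (X (some (1, 2)))) (φ (X (some (0, 1))))
        (φ (X (some (1, 1)))) (fun n => by
          have h1 := hn n
          simp only [Pi.add_apply, Pi.smul_apply, Function.comp_apply, smul_eq_mul, p, q,
            Matrix.cons_val, map_one, map_zero, h2] at h1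
          linear_combination h1)
      rintro (_ | ⟨i, j⟩)
      · exact hT
      · fin_cases i <;> fin_cases j <;> assumption
    -- All coordinates vanish in `K`, so `Q` would be the whole ideal of the origin.
    refine hlt.not_ge fun g hg => ?_
    rw [mem_vanishingIdeal_singleton_iff, aeval_eq_eval_self] at hg
    rw [← hφ]
    have h1 : φ = aeval (R := k) (fun _ => (0 : K)) := by
      ext i
      simp [hall]
    rw [h1]
    have h4 := aeval_algebraMap_apply K (0 : Option (Fin 2 × Fin 3) → k) g
    rw [aeval_eq_eval_self, hg, map_zero] at h4
    convert h4 using 2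
    simp
    rfl
  · simp [p, q]
  · let G : MvPolynomial (Fin 5) K := map (algebraMap k K) (linearizedQuartic k) +
      C (φ (X none)) * (map (algebraMap k K) F - map (algebraMap k K) (linearizedQuartic k))
    have hGe : ∀ x : Fin 5 → K, aeval x G = aeval x (linearizedQuartic k) +
        φ (X none) * (aeval x F - aeval x (linearizedQuartic k)) := by
      intro x
      simp only [G, map_add, map_mul, map_sub, aeval_map_algebraMap, aeval_C,
        Algebra.algebraMap_self, RingHom.id_apply]
    have hG : G.IsHomogeneous 4 := by
      have h3 := (linearizedQuartic_isHomogeneous (k := k)).map (algebraMap k K)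
      have h4 := (isHomogeneous_C (Fin 5) (φ (X none))).mul ((hF.map (algebraMap k K)).sub h3)
      rw [zero_add] at h4
      exact h3.add h4
    intro s t
    rw [← hGe]
    refine aeval_span_pair_eq_zero hG (lineRestrict_eq_zero_of_natCast hG fun n => ?_) s t
    rw [hGe]
    exact hn n

/-- A transcendental element can be specialised to `1` by a valuation. -/
theorem exists_valuationSubring_sub_one_mem_nonunits {K : Type*} [Field K] [Algebra k K] {T : K}
    (hT : Transcendental k T) : ∃ B : ValuationSubring K,
      (∀ c : k, algebraMap k K c ∈ B) ∧ T - 1 ∈ B.nonunits := by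
  let A : Subring K := (Polynomial.aeval (R := k) T).range.toSubring
  have hTA : T - 1 ∈ A := ⟨Polynomial.X - 1, by simp⟩
  obtain ⟨B, hAB, hB⟩ := Ideal.image_subset_nonunits_valuationSubring
    (Ideal.span {(⟨T - 1, hTA⟩ : A)}) (by
      rw [Ne, Ideal.span_singleton_eq_top]
      intro hu
      obtain ⟨⟨y, hy⟩, hy1⟩ := isUnit_iff_exists_inv.mp hu
      obtain ⟨g, rfl⟩ := hy
      have h1 : (T - 1) * Polynomial.aeval T g = 1 := congrArg Subtype.val hy1
      have h2 : Polynomial.aeval T ((Polynomial.X - 1) * g - 1) = 0 := by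
        simp [h1]
      have h3 := (transcendental_iff.mp hT) _ h2
      have h4 := congrArg (Polynomial.eval 1) h3
      simp at h4)
  refine ⟨B, fun c => hAB ⟨Polynomial.C c, by simp⟩, hB ⟨⟨T - 1, hTA⟩, ?_, rfl⟩⟩
  exact Ideal.subset_span rfl

/-- Every quartic threefold contains a line. -/
theorem exists_line_on_quartic [IsAlgClosed k] [CharZero k] {F : MvPolynomial (Fin 5) k}
    (hF : F.IsHomogeneous 4) : ∃ v w : Fin 5 → k, LinearIndependent k ![v, w] ∧
      ∀ s t : k, eval (s • v + t • w) F = 0 := by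
  obtain ⟨K, _, _, T, p, q, hT, hpq, hline⟩ := exists_line_in_pencil hF
  obtain ⟨B, hkB, hTB⟩ := exists_valuationSubring_sub_one_mem_nonunits hT
  obtain ⟨hTB', hTm⟩ := ValuationSubring.mem_nonunits_iff_exists_mem_maximalIdeal.mp hTB
  let M : Fin 5 × Fin 5 → K := fun l => p l.1 * q l.2 - p l.2 * q l.1
  -- Dividing by the minor of largest valuation makes every Plücker coordinate integral.
  obtain ⟨⟨i, j⟩, hij⟩ := Finite.exists_max fun l => B.valuation (M l)
  have hM0 : M (i, j) ≠ 0 := by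
    intro h0
    have h1 := hij (0, 1)
    simp only [h0, map_zero, le_zero_iff, map_eq_zero] at h1
    exact one_ne_zero (hpq.symm.trans h1)
  have hMB : ∀ l, M l / M (i, j) ∈ B := by
    intro l
    rw [← ValuationSubring.valuation_le_one_iff, map_div₀]
    exact div_le_one_of_le₀ (hij l) zero_le
  let kB : k →+* B := (algebraMap k K).codRestrict B.toSubring hkB
  -- The row-reduced basis of the line: columns `i` and `j` form the identity matrix, so
  -- independence survives reduction.
  let V : Fin 2 × Fin 5 → K := fun l => if l.1 = 0 then M (l.2, j) / M (i, j) else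
    M (i, l.2) / M (i, j)
  have hV : ∀ l, V l ∈ B := by
    intro l
    simp only [V]
    split_ifs <;> exact hMB _
  let Φ : MvPolynomial (Fin 2 × Fin 5) k →+* B := eval₂Hom kB fun l => ⟨V l, hV l⟩
  have hΦ : ∀ g, (Φ g : K) = aeval V g := by
    intro g
    have : (B.subtype.comp Φ) = (aeval V : MvPolynomial (Fin 2 × Fin 5) k →ₐ[k] K).toRingHom := by
      ext c
      · simp [Φ, kB]
      · simp [Φ]
    exact DFunLike.congr_fun this g
  let Θ (t : k) : MvPolynomial (Fin 5) k →ₐ[k] MvPolynomial (Fin 2 × Fin 5) k :=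
    aeval fun l => X (0, l) + C t * X (1, l)
  have hΘ : ∀ (t : k) G, (Φ (Θ t G) : K) = aeval (((q j - algebraMap k K t * q i) / M (i, j)) • p +
      ((algebraMap k K t * p i - p j) / M (i, j)) • q) G := by
    intro t G
    rw [hΦ]
    have : (aeval (R := k) V).comp (Θ t) = aeval (((q j - algebraMap k K t * q i) / M (i, j)) • p +
      ((algebraMap k K t * p i - p j) / M (i, j)) • q) := by
      ext l
      simp only [AlgHom.comp_apply, Θ, aeval_X, map_add, map_mul, algHom_C, V, Pi.add_apply,
        Pi.smul_apply, smul_eq_mul]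
      simp only [↓reduceIte, one_ne_zero, M]
      field_simp
      ring
    exact DFunLike.congr_fun this G
  let res := (IsLocalRing.residue B).comp Φ
  have hres : ∀ t, res (Θ t F) = 0 := by
    intro t
    -- The pencil rewritten around `T = 1`: on the line, `F` is a multiple of `T - 1`.
    have h1 : Φ (Θ t F) + (⟨T - 1, hTB'⟩ : B) *
        (Φ (Θ t F) - Φ (Θ t (linearizedQuartic k))) = 0 := by
      refine Subtype.ext ?_
      have h2 := hline ((q j - algebraMap k K t * q i) / M (i, j))
        ((algebraMap k K t * p i - p j) / M (i, j))
      rw [← hΘ, ← hΘ] at h2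
      push_cast
      linear_combination h2
    have h2 : Φ (Θ t F) ∈ IsLocalRing.maximalIdeal B := by
      rw [eq_neg_of_add_eq_zero_left h1]
      exact neg_mem (Ideal.mul_mem_right _ _ hTm)
    exact (IsLocalRing.residue_eq_zero_iff _).mpr h2
  -- The residue field may be larger than `k`; the Nullstellensatz supplies a `k`-point satisfying
  -- the same relations.
  obtain ⟨m, hm, hle⟩ := Ideal.exists_le_maximal (RingHom.ker res) (RingHom.ker_ne_top res)
  obtain ⟨y, rfl⟩ := isMaximal_iff_eq_vanishingIdeal_singleton.mp hm
  have hy : ∀ g, res g = 0 → eval y g = 0 := by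
    intro g hg
    have := (mem_vanishingIdeal_singleton_iff _ _).mp (hle ((RingHom.mem_ker).mpr hg))
    rwa [aeval_eq_eval_self] at this
  have hyX : ∀ (l : Fin 2 × Fin 5) (c : k), V l = algebraMap k K c → y l = c := by
    intro l c hl
    have h1 : res (X l - C c) = 0 := by
      have h2 : Φ (X l - C c) = 0 := Subtype.ext (by rw [hΦ]; simp [hl])
      change IsLocalRing.residue B (Φ (X l - C c)) = 0
      rw [h2, map_zero]
    have h2 := hy _ h1
    simpa [sub_eq_zero] using h2
  have y0i : y (0, i) = 1 := hyX _ _ (by simp [V, div_self hM0])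
  have y0j : y (0, j) = 0 := hyX _ _ (by simp [V, M])
  have y1i : y (1, i) = 0 := hyX _ _ (by simp [V, M])
  have y1j : y (1, j) = 1 := hyX _ _ (by simp [V, div_self hM0])
  refine ⟨fun l => y (0, l), fun l => y (1, l), ?_, ?_⟩
  · rw [LinearIndependent.pair_iff]
    intro s t hst
    have h1 := congrFun hst i
    have h2 := congrFun hst j
    simp [y0i, y1i, y0j, y1j] at h1 h2
    exact ⟨h1, h2⟩
  · have : Infinite k := IsAlgClosed.instInfinite
    have h1 : lineRestrict F (fun l => y (0, l)) (fun l => y (1, l)) = 0 := by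
      refine Polynomial.funext fun t => ?_
      rw [eval_lineRestrict, Polynomial.eval_zero]
      have h2 := hy _ (hres t)
      have h3 : (aeval (R := k) y).comp (Θ t) =
          aeval ((fun l => y (0, l)) + t • fun l => y (1, l)) := by
        ext l
        simp [Θ]
      rw [← h3, AlgHom.comp_apply, aeval_eq_eval_self, h2]
    intro s t
    rw [← aeval_eq_eval_self]
    exact aeval_span_pair_eq_zero hF h1 s t

end Existence

/-! ### Smoothness on the affine cone, and changes of coordinates. -/

section Forms

variable {k : Type*} [Field k]

/-- By Euler's identity in characteristic zero, a common zero of the partials is also a zero of `F`.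
-/
theorem isSmoothForm_of_isSmoothHypersurface [CharZero k] {F : MvPolynomial (Fin 5) k}
    (hF : F.IsHomogeneous 4) (hX : IsSmoothHypersurface F) : IsSmoothForm F := by
  intro x hx
  by_contra hx0
  obtain ⟨c, hc⟩ := Projectivization.exists_smul_eq_mk_rep k x hx0
  have hc' : (Projectivization.mk k x hx0).rep = (c : k) • x := hc.symm
  have hFx : MvPolynomial.eval x F = 0 := by
    have h1 := congrArg (MvPolynomial.eval x) hF.sum_X_mul_pderiv
    simp only [map_sum, map_mul, hx, mul_zero, Finset.sum_const_zero, map_nsmul] at h1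
    simpa using h1.symm
  obtain ⟨i, hi⟩ := hX (Projectivization.mk k x hx0) (by
    change MvPolynomial.eval _ F = 0
    rw [hc', ← aeval_eq_eval_self, IsHomogeneous.aeval_smul hF, aeval_eq_eval_self, hFx, mul_zero])
  rw [hc', ← aeval_eq_eval_self, IsHomogeneous.aeval_smul hF.pderiv, aeval_eq_eval_self, hx i,
    mul_zero] at hi
  exact hi rfl

theorem mem_fanoVariety_iff {F : MvPolynomial (Fin 5) k} (hF : F.IsHomogeneous 4)
    (L : LineGrassmannian k) :
    L ∈ fanoVariety (hypersurface F) ↔ ∀ x ∈ L.1, MvPolynomial.eval x F = 0 := by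
  constructor
  · intro h x hx
    by_cases hx0 : x = 0
    · have h1 := IsHomogeneous.aeval_smul (K := k) hF 0 0
      rw [smul_zero, zero_pow (by norm_num), zero_mul, aeval_eq_eval_self] at h1
      rw [hx0, h1]
    · obtain ⟨c, hc⟩ := Projectivization.exists_smul_eq_mk_rep k x hx0
      have h1 : Projectivization.mk k x hx0 ∈ L.line := by
        change Projectivization.submodule _ ≤ L.1
        rw [Projectivization.submodule_mk, Submodule.span_singleton_le_iff_mem]
        exact hx
      have h2 : MvPolynomial.eval _ F = 0 := h h1
      have hc' : (Projectivization.mk k x hx0).rep = (c : k) • x := hc.symm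
      rw [hc', ← aeval_eq_eval_self, IsHomogeneous.aeval_smul hF, aeval_eq_eval_self] at h2
      exact (mul_eq_zero.mp h2).resolve_left (pow_ne_zero _ c.ne_zero)
  · intro h p hp
    refine h _ (hp ?_)
    rw [Projectivization.submodule_eq]
    exact Submodule.mem_span_singleton_self _

/-- The form `F` in the coordinates given by the basis `e`. -/
noncomputable def changeCoords {ι κ : Type*} [Fintype ι]
    (e : Module.Basis ι k (κ → k)) (F : MvPolynomial κ k) : MvPolynomial ι k :=
  MvPolynomial.aeval (fun l => ∑ j, MvPolynomial.C (e j l) * MvPolynomial.X j) F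

variable {ι κ : Type*} [Fintype ι] (e : Module.Basis ι k (κ → k))

theorem eval_changeCoords (F : MvPolynomial κ k) (y : ι → k) :
    MvPolynomial.eval y (changeCoords e F) = MvPolynomial.eval (∑ j, y j • e j) F := by
  have h : (MvPolynomial.aeval (R := k) y).comp (MvPolynomial.aeval
      (fun l => ∑ j, MvPolynomial.C (e j l) * MvPolynomial.X j)) =
      MvPolynomial.aeval (R := k) (∑ j, y j • e j) := by
    ext i
    simp [mul_comm]
  have h2 := DFunLike.congr_fun h F
  rwa [AlgHom.comp_apply, aeval_eq_eval_self, aeval_eq_eval_self] at h2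

theorem changeCoords_isHomogeneous {F : MvPolynomial κ k} {d : ℕ} (hF : F.IsHomogeneous d) :
    (changeCoords e F).IsHomogeneous d := by
  have h := hF.aeval (n := 1) (fun l => ∑ j, MvPolynomial.C (e j l) * MvPolynomial.X j)
    (fun l => MvPolynomial.IsHomogeneous.sum _ _ _ fun j _ => by
      simpa using (MvPolynomial.isHomogeneous_C ι (e j l)).mul (MvPolynomial.isHomogeneous_X k j))
  rw [one_mul] at h
  exact h

theorem changeCoords_isSmoothForm [Fintype κ] {F : MvPolynomial κ k} (hs : IsSmoothForm F) :
    IsSmoothForm (changeCoords e F) := by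
  classical
  intro y hy
  set x := ∑ j, y j • e j with hx
  let φ : (κ → k) →ₗ[k] k :=
    ∑ i, (MvPolynomial.eval x (MvPolynomial.pderiv i F)) • LinearMap.proj i
  have hφ : ∀ v, φ v = ∑ i, v i * MvPolynomial.eval x (MvPolynomial.pderiv i F) := by
    intro v
    simp [φ, mul_comm]
  have hφ0 : φ = 0 := by
    refine e.ext fun j => ?_
    have h1 := derivation_aeval (MvPolynomial.pderiv j)
      (fun l => ∑ j, MvPolynomial.C (e j l) * MvPolynomial.X j) F
    have h2 := congrArg (MvPolynomial.eval y) h1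
    rw [← changeCoords, hy j, map_sum] at h2
    rw [hφ, LinearMap.zero_apply, h2]
    refine Finset.sum_congr rfl fun i _ => ?_
    rw [map_mul, ← changeCoords, eval_changeCoords]
    congr 1
    simp [MvPolynomial.pderiv_X, Pi.single_apply, Derivation.leibniz]
  have hx0 : x = 0 := hs x fun i => by
    have := LinearMap.congr_fun hφ0 (Pi.single i 1)
    simpa [hφ, Pi.single_apply] using this
  exact funext fun j => Fintype.linearIndependent_iff.mp e.linearIndependent y (hx.symm.trans hx0) j

end Forms

/-! ### Plücker coordinates and homogenization. -/

section Plucker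

variable {k : Type*} [Field k]

theorem exists_plucker_rep_eq {L : LineGrassmannian k} {v w : Fin 5 → k}
    (h : L.1 ≤ Submodule.span k {v, w}) :
    ∃ c : k, c ≠ 0 ∧ (plucker L).rep = c • pluckerVector v w := by
  obtain ⟨a, b, h0⟩ := Submodule.mem_span_pair.mp (h (L.basis 0).2)
  obtain ⟨c, d, h1⟩ := Submodule.mem_span_pair.mp (h (L.basis 1).2)
  obtain ⟨r, hr⟩ := Projectivization.exists_smul_eq_mk_rep k _
    (pluckerVector_ne_zero L.linearIndependent_basis)
  have h2 : pluckerVector (L.basis 0 : Fin 5 → k) (L.basis 1 : Fin 5 → k) =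
      (a * d - b * c) • pluckerVector v w := by
    rw [← h0, ← h1]
    ext ij
    simp only [pluckerVector, Pi.add_apply, Pi.smul_apply, smul_eq_mul]
    ring
  have h3 : (plucker L).rep = ((r : k) * (a * d - b * c)) • pluckerVector v w := by
    rw [mul_smul, ← h2]
    exact hr.symm
  refine ⟨_, fun h0 => (plucker L).rep_nonzero ?_, h3⟩
  rw [h3, h0, zero_smul]

theorem eval_plucker_rep_eq_zero_iff {L : LineGrassmannian k} {v w : Fin 5 → k}
    (h : L.1 ≤ Submodule.span k {v, w}) {f : MvPolynomial PluckerIndex k} {d : ℕ}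
    (hf : f.IsHomogeneous d) :
    MvPolynomial.eval (plucker L).rep f = 0 ↔ MvPolynomial.eval (pluckerVector v w) f = 0 := by
  obtain ⟨c, hc, h1⟩ := exists_plucker_rep_eq h
  rw [h1, ← aeval_eq_eval_self, IsHomogeneous.aeval_smul hf, aeval_eq_eval_self, mul_eq_zero,
    or_iff_right (pow_ne_zero _ hc)]

/-- The linear form in the Plücker coordinates that is given by the wedge product of two linear
functionals. -/
noncomputable def pluckerForm (α β : (Fin 5 → k) →ₗ[k] k) : MvPolynomial PluckerIndex k :=
  ∑ ij : PluckerIndex, MvPolynomial.C (α (Pi.single ij.1.1 1) * β (Pi.single ij.1.2 1) -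
    α (Pi.single ij.1.2 1) * β (Pi.single ij.1.1 1)) * MvPolynomial.X ij

theorem pluckerForm_isHomogeneous (α β : (Fin 5 → k) →ₗ[k] k) :
    (pluckerForm α β).IsHomogeneous 1 :=
  MvPolynomial.IsHomogeneous.sum _ _ _ fun ij _ => (zero_add 1) ▸
    (MvPolynomial.isHomogeneous_C PluckerIndex _).mul (MvPolynomial.isHomogeneous_X k ij)

theorem eval_pluckerForm (α β : (Fin 5 → k) →ₗ[k] k) (v w : Fin 5 → k) :
    MvPolynomial.eval (pluckerVector v w) (pluckerForm α β) = α v * β w - α w * β v := by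
  have hlin : ∀ (γ : (Fin 5 → k) →ₗ[k] k) (x : Fin 5 → k), γ x = ∑ i, x i * γ (Pi.single i 1) := by
    intro γ x
    conv_lhs => rw [← Finset.univ_sum_single x, map_sum]
    refine Finset.sum_congr rfl fun i _ => ?_
    rw [← smul_eq_mul, ← map_smul]
    congr 1
    ext j
    simp [Pi.single_apply]
  rw [hlin α v, hlin α w, hlin β v, hlin β w]
  simp only [pluckerForm, map_sum, map_mul, MvPolynomial.eval_C, MvPolynomial.eval_X, pluckerVector]
  set A : Fin 5 → k := fun i => α (Pi.single i 1)
  set B : Fin 5 → k := fun i => β (Pi.single i 1)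
  have h1 : ∑ ij : PluckerIndex, (A ij.1.1 * B ij.1.2 - A ij.1.2 * B ij.1.1) *
      (v ij.1.1 * w ij.1.2 - v ij.1.2 * w ij.1.1) =
      ∑ ij : Fin 5 × Fin 5, if ij.1 < ij.2 then (A ij.1 * B ij.2 - A ij.2 * B ij.1) *
      (v ij.1 * w ij.2 - v ij.2 * w ij.1) else 0 := by
    rw [← Finset.sum_filter]
    exact (Finset.sum_subtype (Finset.univ.filter fun ij : Fin 5 × Fin 5 => ij.1 < ij.2)
      (by simp) fun ij => (A ij.1 * B ij.2 - A ij.2 * B ij.1) *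
      (v ij.1 * w ij.2 - v ij.2 * w ij.1)).symm
  change ∑ ij : PluckerIndex, (A ij.1.1 * B ij.1.2 - A ij.1.2 * B ij.1.1) *
      (v ij.1.1 * w ij.1.2 - v ij.1.2 * w ij.1.1) = (∑ i, v i * A i) * (∑ i, w i * B i) -
      (∑ i, w i * A i) * (∑ i, v i * B i)
  rw [h1, Fintype.sum_prod_type]
  simp only [Fin.sum_univ_five]
  simp only [Fin.reduceLT, if_true, if_false, Fin.isValue, lt_self_iff_false]
  ring

/-- Denominators are cleared by powers of `m₀`; allowing every large `N` lets the two terms of a sum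
share a degree. -/
theorem exists_homogenization {σ τ : Type*} (m₀ : MvPolynomial τ k) (m : σ → MvPolynomial τ k)
    (hm₀ : m₀.IsHomogeneous 1) (hm : ∀ s, (m s).IsHomogeneous 1) (h : MvPolynomial σ k) :
    ∃ N₀ : ℕ, ∀ N ≥ N₀, ∃ H : MvPolynomial τ k, H.IsHomogeneous N ∧
      ∀ z, MvPolynomial.eval z m₀ ≠ 0 → MvPolynomial.eval z H = MvPolynomial.eval z m₀ ^ N *
        MvPolynomial.eval (fun s => MvPolynomial.eval z (m s) / MvPolynomial.eval z m₀) h := by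
  induction h using MvPolynomial.induction_on with
  | C c =>
    refine ⟨0, fun N _ => ⟨MvPolynomial.C c * m₀ ^ N, ?_, fun z _ => ?_⟩⟩
    · simpa using (MvPolynomial.isHomogeneous_C τ c).mul (hm₀.pow N)
    · simp [mul_comm]
  | add f g hf hg =>
    obtain ⟨N₁, h₁⟩ := hf
    obtain ⟨N₂, h₂⟩ := hg
    refine ⟨max N₁ N₂, fun N hN => ?_⟩
    obtain ⟨H₁, hH₁, he₁⟩ := h₁ N (le_of_max_le_left hN)
    obtain ⟨H₂, hH₂, he₂⟩ := h₂ N (le_of_max_le_right hN)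
    refine ⟨H₁ + H₂, hH₁.add hH₂, fun z hz => ?_⟩
    rw [map_add, he₁ z hz, he₂ z hz, map_add, mul_add]
  | mul_X f s hf =>
    obtain ⟨N₁, h₁⟩ := hf
    refine ⟨N₁ + 1, fun N hN => ?_⟩
    obtain ⟨N, rfl⟩ : ∃ n, N = n + 1 := ⟨N - 1, by omega⟩
    obtain ⟨H₁, hH₁, he₁⟩ := h₁ N (by omega)
    refine ⟨H₁ * m s, hH₁.mul (hm s), fun z hz => ?_⟩
    rw [map_mul, he₁ z hz, map_mul, MvPolynomial.eval_X]
    field_simp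
    ring

end Plucker

/-! ### Affine charts of the Grassmannian. -/

section Chart

variable {k : Type*} [Field k] (e : Module.Basis (Fin 2 ⊕ Fin 3) k (Fin 5 → k))

/-- The two spanning vectors of the line with affine coordinates `x` with respect to `e`. -/
noncomputable def chartVec (x : Fin 2 × Fin 3 → k) (i : Fin 2) : Fin 5 → k :=
  e (Sum.inl i) + ∑ j, x (i, j) • e (Sum.inr j)

theorem coord_inl_chartVec (x : Fin 2 × Fin 3 → k) (i l : Fin 2) :
    e.coord (Sum.inl l) (chartVec e x i) = if i = l then 1 else 0 := by
  simp [chartVec, Finsupp.single_apply]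

theorem coord_inr_chartVec (x : Fin 2 × Fin 3 → k) (i : Fin 2) (j : Fin 3) :
    e.coord (Sum.inr j) (chartVec e x i) = x (i, j) := by
  simp [chartVec, Finsupp.single_apply]

theorem linearIndependent_chartVec (x : Fin 2 × Fin 3 → k) :
    LinearIndependent k (chartVec e x) := by
  rw [Fintype.linearIndependent_iff]
  intro g hg l
  have h := congrArg (e.coord (Sum.inl l)) hg
  simp only [map_sum, map_smul, coord_inl_chartVec, map_zero] at h
  simpa using h

/-- The affine chart of the Grassmannian around the line spanned by `e (inl 0)`, `e (inl 1)`. -/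
noncomputable def chart (x : Fin 2 × Fin 3 → k) : LineGrassmannian k :=
  ⟨Submodule.span k (Set.range (chartVec e x)), by
    rw [finrank_span_eq_card (linearIndependent_chartVec e x), Fintype.card_fin]⟩

theorem chart_eq_span_pair (x : Fin 2 × Fin 3 → k) :
    (chart e x).1 = Submodule.span k {chartVec e x 0, chartVec e x 1} := by
  have h : Set.range (chartVec e x) = {chartVec e x 0, chartVec e x 1} := by
    ext y
    simp [Fin.exists_fin_two, eq_comm]
  rw [← h]
  rfl

theorem chart_injective : Function.Injective (chart e) := by
  intro x y hxy
  ext ⟨i, j⟩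
  have h1 : chartVec e x i ∈ (chart e y).1 := by
    rw [← hxy]
    exact Submodule.subset_span ⟨i, rfl⟩
  obtain ⟨g, hg⟩ := (Submodule.mem_span_range_iff_exists_fun k).mp h1
  have h2 : ∀ l, g l = if i = l then 1 else 0 := by
    intro l
    have h := congrArg (e.coord (Sum.inl l)) hg
    simp only [map_sum, map_smul, coord_inl_chartVec] at h
    simpa using h
  have h3 := congrArg (e.coord (Sum.inr j)) hg
  simp only [map_sum, map_smul, coord_inr_chartVec, h2] at h3
  simpa using h3.symm

theorem chart_eq_of_mem {L : LineGrassmannian k} {x : Fin 2 × Fin 3 → k}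
    (h : ∀ i, chartVec e x i ∈ L.1) : chart e x = L := by
  refine Subtype.ext (Submodule.eq_of_le_of_finrank_eq ?_ ((chart e x).2.trans L.2.symm))
  rw [chart, Submodule.span_le]
  rintro _ ⟨i, rfl⟩
  exact h i

/-- The chart is continuous for the Zariski topology on the affine space. -/
theorem exists_eval_ne_zero_of_chart_mem {U : Set (LineGrassmannian k)} (hU : IsOpen U)
    {x : Fin 2 × Fin 3 → k} (hx : chart e x ∈ U) :
    ∃ h : MvPolynomial (Fin 2 × Fin 3) k, MvPolynomial.eval x h ≠ 0 ∧
      ∀ y, MvPolynomial.eval y h ≠ 0 → chart e y ∈ U := by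
  obtain ⟨O, hO, rfl⟩ := (@isOpen_induced_iff _ _ (zariskiTopology k PluckerIndex) _ _).mp hU
  change plucker (chart e x) ∈ O at hx
  change TopologicalSpace.GenerateOpen _ O at hO
  change ∃ h : MvPolynomial (Fin 2 × Fin 3) k, MvPolynomial.eval x h ≠ 0 ∧
      ∀ y, MvPolynomial.eval y h ≠ 0 → plucker (chart e y) ∈ O
  clear hU
  induction hO with
  | basic O hO =>
    obtain ⟨d, f, hf, rfl⟩ := hO
    let V : Fin 2 → Fin 5 → MvPolynomial (Fin 2 × Fin 3) k := fun i l =>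
      MvPolynomial.C (e (Sum.inl i) l) +
        ∑ j, MvPolynomial.X (i, j) * MvPolynomial.C (e (Sum.inr j) l)
    have hV : ∀ y i l, MvPolynomial.eval y (V i l) = chartVec e y i l := by
      intro y i l
      simp [V, chartVec]
    let h : MvPolynomial (Fin 2 × Fin 3) k := MvPolynomial.aeval (fun ij : PluckerIndex =>
      V 0 ij.1.1 * V 1 ij.1.2 - V 0 ij.1.2 * V 1 ij.1.1) f
    have hh : ∀ y, MvPolynomial.eval y h =
        MvPolynomial.eval (pluckerVector (chartVec e y 0) (chartVec e y 1)) f := by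
      intro y
      have h1 : (MvPolynomial.aeval (R := k) y).comp
          (MvPolynomial.aeval (fun ij : PluckerIndex =>
            V 0 ij.1.1 * V 1 ij.1.2 - V 0 ij.1.2 * V 1 ij.1.1)) =
          MvPolynomial.aeval (pluckerVector (chartVec e y 0) (chartVec e y 1)) := by
        ext ij
        simp only [AlgHom.comp_apply, MvPolynomial.aeval_X, map_sub, map_mul, aeval_eq_eval_self,
          hV, MvPolynomial.eval_X, pluckerVector]
      have h2 := DFunLike.congr_fun h1 f
      rwa [AlgHom.comp_apply, aeval_eq_eval_self, aeval_eq_eval_self] at h2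
    have hiff : ∀ y, MvPolynomial.eval y h ≠ 0 ↔
        MvPolynomial.eval (plucker (chart e y)).rep f ≠ 0 := fun y => by
      rw [hh, Ne, Ne, eval_plucker_rep_eq_zero_iff (chart_eq_span_pair e y).le hf]
    exact ⟨h, (hiff x).mpr hx, fun y hy => (hiff y).mp hy⟩
  | univ => exact ⟨1, by simp, fun y _ => trivial⟩
  | inter s t _ _ hs ht =>
    obtain ⟨f, hfx, hf⟩ := hs hx.1
    obtain ⟨g, hgx, hg⟩ := ht hx.2
    refine ⟨f * g, by rw [map_mul]; exact mul_ne_zero hfx hgx, fun y hy => ?_⟩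
    rw [map_mul] at hy
    exact ⟨hf y (left_ne_zero_of_mul hy), hg y (right_ne_zero_of_mul hy)⟩
  | sUnion S _ hS =>
    obtain ⟨O, hOS, hxO⟩ := hx
    obtain ⟨f, hfx, hf⟩ := hS O hOS hxO
    exact ⟨f, hfx, fun y hy => ⟨O, hOS, hf y hy⟩⟩

/-- The chart is open for the Zariski topology on the affine space. -/
theorem exists_isOpen_chart {h : MvPolynomial (Fin 2 × Fin 3) k} {x : Fin 2 × Fin 3 → k}
    (hx : MvPolynomial.eval x h ≠ 0) :
    ∃ U : Set (LineGrassmannian k), IsOpen U ∧ chart e x ∈ U ∧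
      ∀ L ∈ U, ∃ y, chart e y = L ∧ MvPolynomial.eval y h ≠ 0 := by
  -- By Cramer's rule the chart coordinates are the ratios `m s / m₀`, and `m₀ ≠ 0` describes the
  -- image of the chart.
  let m₀ := pluckerForm (e.coord (Sum.inl 0)) (e.coord (Sum.inl 1))
  let m : Fin 2 × Fin 3 → MvPolynomial PluckerIndex k := fun s =>
    if s.1 = 0 then pluckerForm (e.coord (Sum.inr s.2)) (e.coord (Sum.inl 1))
    else pluckerForm (e.coord (Sum.inl 0)) (e.coord (Sum.inr s.2))
  obtain ⟨N, hN⟩ := exists_homogenization m₀ m (pluckerForm_isHomogeneous _ _) (fun s => by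
    simp only [m]
    split_ifs <;> exact pluckerForm_isHomogeneous _ _) h
  obtain ⟨H, hH, hHe⟩ := hN N le_rfl
  have hom : (m₀ * H).IsHomogeneous (1 + N) := (pluckerForm_isHomogeneous _ _).mul hH
  refine ⟨{L | MvPolynomial.eval (plucker L).rep (m₀ * H) ≠ 0}, ?_, ?_, ?_⟩
  · exact (@isOpen_induced_iff _ _ (zariskiTopology k PluckerIndex) _ _).mpr
      ⟨{p | MvPolynomial.eval p.rep (m₀ * H) ≠ 0},
      TopologicalSpace.isOpen_generateFrom_of_mem ⟨_, _, hom, rfl⟩, rfl⟩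
  · have h0 : MvPolynomial.eval (pluckerVector (chartVec e x 0) (chartVec e x 1)) m₀ = 1 := by
      simp only [m₀, eval_pluckerForm, coord_inl_chartVec]
      simp
    have hxs : (fun s => MvPolynomial.eval (pluckerVector (chartVec e x 0) (chartVec e x 1)) (m s) /
        MvPolynomial.eval (pluckerVector (chartVec e x 0) (chartVec e x 1)) m₀) = x := by
      ext ⟨i, j⟩
      rw [h0]
      fin_cases i <;> simp [m, eval_pluckerForm, -Module.Basis.coord_apply, coord_inl_chartVec,
        coord_inr_chartVec]
    change MvPolynomial.eval _ _ ≠ 0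
    rw [Ne, eval_plucker_rep_eq_zero_iff (chart_eq_span_pair e x).le hom, map_mul,
      hHe _ (by rw [h0]; exact one_ne_zero), hxs, h0]
    simpa using hx
  · intro L hL
    set v : Fin 5 → k := (L.basis 0).1 with hv
    set w : Fin 5 → k := (L.basis 1).1 with hw
    have hspan : L.1 ≤ Submodule.span k {v, w} := by
      intro y hy
      have := L.basis.sum_repr ⟨y, hy⟩
      rw [Fin.sum_univ_two] at this
      have h2 := congrArg Subtype.val this
      exact Submodule.mem_span_pair.mpr ⟨_, _, h2⟩
    change MvPolynomial.eval _ _ ≠ 0 at hL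
    rw [Ne, eval_plucker_rep_eq_zero_iff hspan hom, map_mul] at hL
    have h0 := left_ne_zero_of_mul hL
    have h1 := right_ne_zero_of_mul hL
    rw [hHe _ h0] at h1
    refine ⟨_, ?_, right_ne_zero_of_mul h1⟩
    have hvL : v ∈ L.1 := (L.basis 0).2
    have hwL : w ∈ L.1 := (L.basis 1).2
    set z := pluckerVector v w with hz
    set δ := MvPolynomial.eval z m₀ with hδ
    have hδ' : δ = e.coord (Sum.inl 0) v * e.coord (Sum.inl 1) w -
        e.coord (Sum.inl 0) w * e.coord (Sum.inl 1) v := eval_pluckerForm _ _ _ _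
    refine chart_eq_of_mem e fun i => ?_
    fin_cases i
    · have : chartVec e (fun s => MvPolynomial.eval z (m s) / δ) 0 =
          (e.coord (Sum.inl 1) w / δ) • v - (e.coord (Sum.inl 1) v / δ) • w := by
        refine e.ext_elem fun s => ?_
        rw [← Module.Basis.coord_apply, ← Module.Basis.coord_apply, map_sub, map_smul, map_smul]
        rcases s with l | j
        · rw [coord_inl_chartVec]
          fin_cases l
          · simp only [Fin.zero_eta, if_true, smul_eq_mul]
            field_simp
            rw [hδ']; ring
          · simp only [Fin.mk_one, smul_eq_mul]
            simp
            ring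
        · rw [coord_inr_chartVec]
          simp only [m, if_true, hz, eval_pluckerForm, smul_eq_mul]
          ring
      change chartVec e _ 0 ∈ L.1
      rw [this]
      exact sub_mem (L.1.smul_mem _ hvL) (L.1.smul_mem _ hwL)
    · have : chartVec e (fun s => MvPolynomial.eval z (m s) / δ) 1 =
          (e.coord (Sum.inl 0) v / δ) • w - (e.coord (Sum.inl 0) w / δ) • v := by
        refine e.ext_elem fun s => ?_
        rw [← Module.Basis.coord_apply, ← Module.Basis.coord_apply, map_sub, map_smul, map_smul]
        rcases s with l | j
        · rw [coord_inl_chartVec]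
          fin_cases l
          · simp only [Fin.zero_eta, smul_eq_mul]
            simp
            ring
          · simp only [Fin.mk_one, if_true, smul_eq_mul]
            field_simp
            rw [hδ']
        · rw [coord_inr_chartVec]
          simp only [m, one_ne_zero, if_false, hz, eval_pluckerForm, smul_eq_mul]
          ring
      change chartVec e _ 1 ∈ L.1
      rw [this]
      exact sub_mem (L.1.smul_mem _ hwL) (L.1.smul_mem _ hvL)

end Chart

section Chart

variable {k : Type*} [Field k]

theorem exists_chart_zero_eq (L : LineGrassmannian k) :
    ∃ e : Module.Basis (Fin 2 ⊕ Fin 3) k (Fin 5 → k), chart e 0 = L := by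
  obtain ⟨W, hW⟩ := Submodule.exists_isCompl L.1
  have hr : Module.finrank k W = 3 := by
    have h1 := Submodule.finrank_add_eq_of_isCompl hW
    rw [L.2, Module.finrank_fintype_fun_eq_card, Fintype.card_fin] at h1
    omega
  let e := (L.basis.prod (Module.finBasisOfFinrankEq k W hr)).map
    (Submodule.prodEquivOfIsCompl L.1 W hW)
  refine ⟨e, chart_eq_of_mem e fun i => ?_⟩
  have : chartVec e 0 i = L.basis i := by
    simp [chartVec, e]
  rw [this]
  exact (L.basis i).2

end Chart

/-! ### Equations of the Fano variety in a chart. -/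

section FanoChart

variable {k : Type*} [Field k] {F : MvPolynomial (Fin 5) k}
  (e : Module.Basis (Fin 2 ⊕ Fin 3) k (Fin 5 → k))

/-- The value of `F` at the point with parameter `t` of the line with indeterminate coordinates. -/
noncomputable def chartEquation (F : MvPolynomial (Fin 5) k) (t : k) :
    MvPolynomial (Fin 2 × Fin 3) k :=
  MvPolynomial.aeval (Sum.elim ![1, MvPolynomial.C t]
    fun j => MvPolynomial.X (0, j) + MvPolynomial.C t * MvPolynomial.X (1, j)) (changeCoords e F)

theorem aeval_chartEquation {K : Type*} [Field K] [Algebra k K] (x : Fin 2 × Fin 3 → K) (t : k) :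
    MvPolynomial.aeval x (chartEquation e F t) =
      (lineRestrict (changeCoords e F) (lineFst fun j => x (0, j))
        (lineSnd fun j => x (1, j))).eval (algebraMap k K t) := by
  rw [eval_lineRestrict, chartEquation, ← AlgHom.comp_apply, MvPolynomial.comp_aeval]
  congr 2
  ext i
  rcases i with i | j
  · fin_cases i <;> simp [Algebra.smul_def]
  · simp [Algebra.smul_def]

theorem chart_mem_fanoVariety_iff [Infinite k] (hF : F.IsHomogeneous 4) (x : Fin 2 × Fin 3 → k) :
    chart e x ∈ fanoVariety (hypersurface F) ↔
      lineRestrict (changeCoords e F) (lineFst fun j => x (0, j))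
        (lineSnd fun j => x (1, j)) = 0 := by
  have hsum : ∀ s t : k,
      ∑ i, (s • lineFst (fun j => x (0, j)) + t • lineSnd (fun j => x (1, j))) i •
      e i = s • chartVec e x 0 + t • chartVec e x 1 := by
    intro s t
    simp only [Fintype.sum_sum_type, Fin.sum_univ_two, Fin.sum_univ_three, chartVec, Pi.add_apply,
      Pi.smul_apply, Sum.elim_inl, Sum.elim_inr, smul_eq_mul, Matrix.cons_val_zero,
      Matrix.cons_val_one]
    module
  rw [mem_fanoVariety_iff hF]
  constructor
  · intro h
    refine Polynomial.funext fun t => ?_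
    rw [eval_lineRestrict, aeval_eq_eval_self, eval_changeCoords, Polynomial.eval_zero]
    have h1 := hsum 1 t
    rw [one_smul] at h1
    rw [h1]
    refine h _ ?_
    rw [chart_eq_span_pair]
    exact Submodule.mem_span_pair.mpr ⟨_, _, rfl⟩
  · intro h y hy
    rw [chart_eq_span_pair] at hy
    obtain ⟨s, t, rfl⟩ := Submodule.mem_span_pair.mp hy
    have h1 := aeval_span_pair_eq_zero (changeCoords_isHomogeneous e hF) h s t
    rwa [aeval_eq_eval_self, eval_changeCoords, hsum] at h1

theorem chart_mem_fanoVariety_iff_natCast [CharZero k] (hF : F.IsHomogeneous 4)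
    (x : Fin 2 × Fin 3 → k) :
    chart e x ∈ fanoVariety (hypersurface F) ↔
      ∀ n : Fin 5, MvPolynomial.eval x (chartEquation e F ((n : ℕ) : k)) = 0 := by
  rw [chart_mem_fanoVariety_iff e hF]
  simp only [← aeval_eq_eval_self, aeval_chartEquation]
  refine ⟨fun h n => by rw [h, Polynomial.eval_zero], fun h => ?_⟩
  refine lineRestrict_eq_zero_of_natCast (changeCoords_isHomogeneous e hF) fun n => ?_
  rw [← h n, eval_lineRestrict]
  simp

end FanoChart

/-! ### Every component has dimension at least one. -/

section LowerBound

variable {k : Type*} [Field k] [IsAlgClosed k] [CharZero k] {F : MvPolynomial (Fin 5) k}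

theorem one_le_topologicalKrullDim_of_mem_irreducibleComponents (hF : F.IsHomogeneous 4)
    {Z : Set (fanoVariety (hypersurface F))}
    (hZ : Z ∈ irreducibleComponents (fanoVariety (hypersurface F))) :
    1 ≤ topologicalKrullDim Z := by
  have hirr : IsIrreducible Z := hZ.1
  obtain ⟨z, hz⟩ := hirr.nonempty
  obtain ⟨e, he⟩ := exists_chart_zero_eq z.1
  obtain ⟨Q, hQ, hfQ, hlt⟩ := exists_isPrime_lt_vanishingIdeal (by simp)
    (fun n : Fin 5 => chartEquation e F ((n : ℕ) : k)) 0
    ((chart_mem_fanoVariety_iff_natCast e hF 0).mp (by rw [he]; exact z.2))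
  obtain ⟨y, hyQ, hy0⟩ := exists_ne_mem_zeroLocus hlt
  have hmem : ∀ x ∈ MvPolynomial.zeroLocus k Q, chart e x ∈ fanoVariety (hypersurface F) := by
    intro x hx
    rw [chart_mem_fanoVariety_iff_natCast e hF]
    intro n
    rw [← aeval_eq_eval_self]
    exact hx _ (hfQ n)
  let S : Set (fanoVariety (hypersurface F)) :=
    {t | ∃ x ∈ MvPolynomial.zeroLocus k Q, chart e x = t.1}
  have hzS : z ∈ S := ⟨0, fun f hf => (MvPolynomial.mem_vanishingIdeal_singleton_iff _ _).mp
    (hlt.le hf), he⟩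
  have hS : IsIrreducible S := by
    refine ⟨⟨z, hzS⟩, ?_⟩
    rintro U V hU hV ⟨t₁, ⟨x₁, hx₁, h₁⟩, ht₁⟩ ⟨t₂, ⟨x₂, hx₂, h₂⟩, ht₂⟩
    obtain ⟨U', hU', rfl⟩ := isOpen_induced_iff.mp hU
    obtain ⟨V', hV', rfl⟩ := isOpen_induced_iff.mp hV
    obtain ⟨f, hf, hfU⟩ := exists_eval_ne_zero_of_chart_mem e hU' (x := x₁) (by rw [h₁]; exact ht₁)
    obtain ⟨g, hg, hgV⟩ := exists_eval_ne_zero_of_chart_mem e hV' (x := x₂) (by rw [h₂]; exact ht₂)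
    have hfQ' : f ∉ Q := fun h => hf (by rw [← aeval_eq_eval_self]; exact hx₁ f h)
    have hgQ' : g ∉ Q := fun h => hg (by rw [← aeval_eq_eval_self]; exact hx₂ g h)
    have hfg : f * g ∉ Q := fun h => (hQ.mem_or_mem h).elim hfQ' hgQ'
    rw [← MvPolynomial.IsPrime.vanishingIdeal_zeroLocus (K := k) Q,
      MvPolynomial.mem_vanishingIdeal_iff] at hfg
    push Not at hfg
    obtain ⟨x, hx, hfgx⟩ := hfg
    rw [aeval_eq_eval_self, map_mul] at hfgx
    exact ⟨⟨chart e x, hmem x hx⟩, ⟨x, hx, rfl⟩, hfU x (left_ne_zero_of_mul hfgx),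
      hgV x (right_ne_zero_of_mul hfgx)⟩
  -- Otherwise maximality of `Z` puts the whole irreducible set `S` into the closure of `z`, yet
  -- some chart coordinate separates `z` from the point with coordinates `y`.
  have hne : closure {(⟨z, hz⟩ : Z)} ≠ Set.univ := by
    intro htop
    have hZz : Z ⊆ closure {z} := by
      intro t ht
      have h1 : (⟨t, ht⟩ : Z) ∈ closure {(⟨z, hz⟩ : Z)} := htop ▸ Set.mem_univ _
      rw [closure_subtype] at h1
      simpa using h1
    have hZS : Z ≤ closure S := hZz.trans (closure_mono (Set.singleton_subset_iff.mpr hzS))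
    have hSZ : closure S ≤ Z := hZ.2 hS.closure hZS
    have hyz : (⟨chart e y, hmem y hyQ⟩ : fanoVariety (hypersurface F)) ∈ closure {z} :=
      hZz (hSZ (subset_closure ⟨y, hyQ, rfl⟩))
    obtain ⟨s, hs⟩ := Function.ne_iff.mp hy0
    obtain ⟨U, hU, hyU, hUs⟩ := exists_isOpen_chart e (h := MvPolynomial.X s) (x := y)
      (by simpa using hs)
    obtain ⟨t, htU, rfl⟩ := mem_closure_iff.mp hyz (Subtype.val ⁻¹' U)
      (hU.preimage continuous_subtype_val) hyU
    obtain ⟨x, hx, hxs⟩ := hUs t.1 htU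
    rw [chart_injective e (hx.trans he.symm)] at hxs
    simp at hxs
  have : IrreducibleSpace Z := Subtype.irreducibleSpace hirr
  rw [topologicalKrullDim, Order.one_le_krullDim_iff]
  refine ⟨⟨closure {(⟨z, hz⟩ : Z)}, isIrreducible_singleton.closure, isClosed_closure⟩,
    ⟨Set.univ, IrreducibleSpace.isIrreducible_univ _, isClosed_univ⟩, ?_⟩
  exact lt_of_le_of_ne (Set.subset_univ _) fun h => hne (congrArg (fun C => C.carrier) h)

end LowerBound

/-! ### From chains of closed sets to algebraically independent functions. -/

section Chains

/-- Modulo `P₁` the element `w` is not constant, hence transcendental. An algebraic relation for `u`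
over `k[w]`, with nonzero constant coefficient, would put that coefficient into `P₁`, since `u` lies
in `P₁`. -/
theorem algebraicIndependent_of_prime_chain {k : Type*} [Field k] [IsAlgClosed k] {R : Type*}
    [CommRing R] [Algebra k R] {P₂ P₁ m : Ideal R} [P₁.IsPrime] (h₂₁ : P₂ ≤ P₁) (h₁ : P₁ ≤ m)
    (hm : m ≠ ⊤) {K : Type*} [Field K] [Algebra k K] (φ : R →ₐ[k] K)
    (hφ : ∀ g, φ g = 0 ↔ g ∈ P₂) {u w : R} (huP₁ : u ∈ P₁) (huP₂ : u ∉ P₂) (hwm : w ∈ m)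
    (hwP₁ : w ∉ P₁) :
    AlgebraicIndependent k (fun o : Option Unit => o.elim (φ u) fun _ => φ w) := by
  have hconst : ∀ g : Polynomial k, Polynomial.aeval w g ∈ P₁ → g = 0 := by
    intro g hg
    by_contra hg0
    have halg : IsAlgebraic k (Ideal.Quotient.mkₐ k P₁ w) := by
      refine ⟨g, hg0, ?_⟩
      rw [Polynomial.aeval_algHom_apply]
      exact Ideal.Quotient.eq_zero_iff_mem.mpr hg
    obtain ⟨c, hc⟩ := exists_algebraMap_eq_of_isAlgebraic halg
    have h3 : w - algebraMap k R c ∈ P₁ := by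
      rw [← Ideal.Quotient.eq_zero_iff_mem, map_sub, sub_eq_zero]
      exact hc.symm
    have h4 : algebraMap k R c ∈ m := by
      have := m.sub_mem hwm (h₁ h3)
      rwa [sub_sub_cancel] at this
    have hc0 : c = 0 := by
      by_contra hc0
      exact hm (Ideal.eq_top_of_isUnit_mem _ h4 ((IsUnit.mk0 c hc0).map (algebraMap k R)))
    rw [hc0, map_zero, sub_zero] at h3
    exact hwP₁ h3
  have hw : Transcendental k (φ w) := by
    rw [transcendental_iff]
    intro g hg
    rw [Polynomial.aeval_algHom_apply, hφ] at hg
    exact hconst g (h₂₁ hg)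
  rw [AlgebraicIndependent.option_iff]
  refine ⟨algebraicIndependent_unique_type_iff.mpr hw, fun halg => ?_⟩
  obtain ⟨q, hq0, hq⟩ := halg.exists_nonzero_coeff_and_aeval_eq_zero
    (mem_nonZeroDivisors_of_ne_zero fun h => huP₂ ((hφ u).mp h))
  have hadj : ∀ a : Algebra.adjoin k (Set.range fun _ : Unit => φ w),
      ∃ g : Polynomial k, (a : K) = Polynomial.aeval (φ w) g := by
    rintro ⟨a, ha⟩
    rw [Set.range_const, Algebra.adjoin_singleton_eq_range_aeval] at ha
    obtain ⟨g, hg⟩ := ha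
    exact ⟨g, hg.symm⟩
  have hrange : ∀ p : Polynomial (Algebra.adjoin k (Set.range fun _ : Unit => φ w)),
      ∃ r, φ r = Polynomial.aeval (φ u) p := by
    intro p
    rw [Polynomial.aeval_eq_sum_range]
    change _ ∈ φ.range
    refine sum_mem fun i _ => ?_
    obtain ⟨g, hg⟩ := hadj (p.coeff i)
    rw [Algebra.smul_def]
    refine φ.range.mul_mem ⟨Polynomial.aeval w g, ?_⟩ (φ.range.pow_mem ⟨u, rfl⟩ i)
    change φ _ = _
    rw [← Polynomial.aeval_algHom_apply, ← hg]
    rfl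
  obtain ⟨g, hg⟩ := hadj (q.coeff 0)
  obtain ⟨r, hr⟩ := hrange q.divX
  have h3 : φ (r * u + Polynomial.aeval w g) = 0 := by
    rw [← hq]
    conv_rhs => rw [← Polynomial.divX_mul_X_add q]
    rw [map_add, map_add, map_mul, map_mul, Polynomial.aeval_X, Polynomial.aeval_C, hr,
      ← Polynomial.aeval_algHom_apply, ← hg]
    rfl
  have h4 : Polynomial.aeval w g ∈ P₁ := by
    have h5 := P₁.sub_mem (h₂₁ ((hφ _).mp h3)) (P₁.mul_mem_left r huP₁)
    rwa [add_sub_cancel_left] at h5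
  refine hq0 (Subtype.ext ?_)
  rw [hg, hconst g h4, map_zero]
  rfl

variable {k : Type*} [Field k] {T : Set (LineGrassmannian k)}
  (e : Module.Basis (Fin 2 ⊕ Fin 3) k (Fin 5 → k))

/-- The ideal of the polynomials in the chart that vanish on `C`. -/
noncomputable def chartIdeal (C : Set T) : Ideal (MvPolynomial (Fin 2 × Fin 3) k) :=
  MvPolynomial.vanishingIdeal k {x | ∃ t ∈ C, t.1 = chart e x}

theorem mem_chartIdeal_iff {C : Set T} {f : MvPolynomial (Fin 2 × Fin 3) k} :
    f ∈ chartIdeal e C ↔ ∀ x, ∀ t ∈ C, t.1 = chart e x → MvPolynomial.eval x f = 0 := by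
  rw [chartIdeal, MvPolynomial.mem_vanishingIdeal_iff]
  simp only [aeval_eq_eval_self, Set.mem_ofPred_eq]
  exact ⟨fun h x t ht hx => h x ⟨t, ht, hx⟩, fun h x ⟨t, ht, hx⟩ => h x t ht hx⟩

theorem chartIdeal_isPrime {C : Set T} (hC : IsIrreducible C) {x₀ : Fin 2 × Fin 3 → k} {t₀ : T}
    (ht₀ : t₀ ∈ C) (h₀ : t₀.1 = chart e x₀) : (chartIdeal e C).IsPrime := by
  refine ⟨fun htop => ?_, fun {f g} hfg => ?_⟩
  · have h1 : (1 : MvPolynomial (Fin 2 × Fin 3) k) ∈ chartIdeal e C := htop ▸ Submodule.mem_top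
    have h2 := (mem_chartIdeal_iff e).mp h1 x₀ t₀ ht₀ h₀
    simp at h2
  · by_contra! hcon
    simp only [mem_chartIdeal_iff] at hcon hfg
    push Not at hcon
    obtain ⟨⟨x₁, t₁, ht₁, h₁, hf⟩, x₂, t₂, ht₂, h₂, hg⟩ := hcon
    obtain ⟨U, hU, hxU, hUf⟩ := exists_isOpen_chart e hf
    obtain ⟨V, hV, hxV, hVg⟩ := exists_isOpen_chart e hg
    obtain ⟨t, ht, htU, htV⟩ := hC.2 (Subtype.val ⁻¹' U) (Subtype.val ⁻¹' V)
      (hU.preimage continuous_subtype_val) (hV.preimage continuous_subtype_val)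
      ⟨t₁, ht₁, by change t₁.1 ∈ U; rwa [h₁]⟩ ⟨t₂, ht₂, by change t₂.1 ∈ V; rwa [h₂]⟩
    obtain ⟨y₁, hy₁, hfy⟩ := hUf _ htU
    obtain ⟨y₂, hy₂, hgy⟩ := hVg _ htV
    have hy : y₂ = y₁ := chart_injective e (hy₂.trans hy₁.symm)
    have h3 := hfg y₁ t ht hy₁.symm
    rw [map_mul] at h3
    exact mul_ne_zero hfy (hy ▸ hgy) h3

theorem exists_mem_chartIdeal_notMem {C C' : Set T} (hC : IsClosed C) (hC' : IsIrreducible C')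
    (hlt : C ⊂ C') {x₀ : Fin 2 × Fin 3 → k} {t₀ : T} (ht₀ : t₀ ∈ C) (h₀ : t₀.1 = chart e x₀) :
    ∃ f ∈ chartIdeal e C, f ∉ chartIdeal e C' := by
  obtain ⟨t₁, ht₁, ht₁C⟩ := Set.exists_of_ssubset hlt
  -- With `h = 1` this is a neighbourhood inside the chart; irreducibility of `C'` moves a point
  -- outside `C` into it.
  obtain ⟨U, hU, hxU, hUe⟩ := exists_isOpen_chart e (h := 1) (x := x₀) (by simp)
  obtain ⟨t, ht, htU, htC⟩ := hC'.2 (Subtype.val ⁻¹' U) Cᶜ (hU.preimage continuous_subtype_val)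
    hC.isOpen_compl ⟨t₀, hlt.subset ht₀, by change t₀.1 ∈ U; rwa [h₀]⟩ ⟨t₁, ht₁, ht₁C⟩
  obtain ⟨x, hx, -⟩ := hUe _ htU
  obtain ⟨O, hO, hOC⟩ := isOpen_induced_iff.mp hC.isOpen_compl
  have htO : t ∈ Subtype.val ⁻¹' O := by rw [hOC]; exact htC
  obtain ⟨f, hfx, hf⟩ := exists_eval_ne_zero_of_chart_mem e hO (x := x) (by rw [hx]; exact htO)
  refine ⟨f, ?_, ?_⟩
  · rw [mem_chartIdeal_iff]
    intro y s hs hy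
    by_contra hne
    have h1 : s ∈ Subtype.val ⁻¹' O := by
      change s.1 ∈ O
      rw [hy]
      exact hf y hne
    rw [hOC] at h1
    exact h1 hs
  · rw [mem_chartIdeal_iff]
    exact fun h => hfx (h x t ht hx.symm)

theorem chartIdeal_anti {C C' : Set T} (h : C ⊆ C') : chartIdeal e C' ≤ chartIdeal e C := by
  intro f hf
  rw [mem_chartIdeal_iff] at hf ⊢
  exact fun x t ht hx => hf x t (h ht) hx

end Chains

/-! ### The Fano variety has dimension at most one. -/

section UpperBoundFano

variable {k : Type*} [Field k] [IsAlgClosed k] [CharZero k] {F : MvPolynomial (Fin 5) k}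

theorem topologicalKrullDim_fanoVariety_le_one (hF : F.IsHomogeneous 4) (hs : IsSmoothForm F) :
    topologicalKrullDim (fanoVariety (hypersurface F)) ≤ 1 := by
  have : Infinite k := IsAlgClosed.instInfinite
  rw [topologicalKrullDim, Order.krullDim_le_one_iff]
  by_contra! hcon
  obtain ⟨C₁, hmin, hmax⟩ := hcon
  obtain ⟨C₀, h₀₁⟩ := not_isMin_iff.mp hmin
  obtain ⟨C₂, h₁₂⟩ := not_isMax_iff.mp hmax
  obtain ⟨z, hz⟩ := C₀.isIrreducible.nonempty
  have hz₁ : z ∈ C₁.carrier := h₀₁.le hz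
  have hz₂ : z ∈ C₂.carrier := h₁₂.le hz₁
  obtain ⟨e, he⟩ := exists_chart_zero_eq z.1
  obtain ⟨w, hw₀, hw₁⟩ := exists_mem_chartIdeal_notMem e C₀.isClosed C₁.isIrreducible h₀₁ hz he.symm
  obtain ⟨u, hu₁, hu₂⟩ := exists_mem_chartIdeal_notMem e C₁.isClosed C₂.isIrreducible h₁₂ hz₁
    he.symm
  have hP₀ := chartIdeal_isPrime e C₀.isIrreducible hz he.symm
  have hP₁ := chartIdeal_isPrime e C₁.isIrreducible hz₁ he.symm
  have hP₂ := chartIdeal_isPrime e C₂.isIrreducible hz₂ he.symm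
  set P := chartIdeal e C₂.carrier with hP
  let R := MvPolynomial (Fin 2 × Fin 3) k
  let K := FractionRing (R ⧸ P)
  let φ : R →ₐ[k] K := (IsScalarTower.toAlgHom k (R ⧸ P) K).comp (Ideal.Quotient.mkₐ k P)
  have hφ : ∀ g, φ g = 0 ↔ g ∈ P := by
    intro g
    rw [← Ideal.Quotient.eq_zero_iff_mem, ← (IsFractionRing.injective (R ⧸ P) K).eq_iff, map_zero]
    rfl
  have hind := algebraicIndependent_of_prime_chain (chartIdeal_anti e h₁₂.le)
    (chartIdeal_anti e h₀₁.le) hP₀.ne_top φ hφ hu₁ hu₂ hw₀ hw₁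
  -- `D₁` and `D₂` are dual to the images of `u` and `w`, which makes them independent.
  obtain ⟨D₁, hD₁⟩ := exists_derivation_of_algebraicIndependent hind fun o => o.elim 1 fun _ => 0
  obtain ⟨D₂, hD₂⟩ := exists_derivation_of_algebraicIndependent hind fun o => o.elim 0 fun _ => 1
  have hφX : φ = MvPolynomial.aeval fun s => φ (MvPolynomial.X s) := by
    ext s
    simp
  refine not_exists_independent_derivations (K := K) (a := fun j => φ (MvPolynomial.X (0, j)))
    (b := fun j => φ (MvPolynomial.X (1, j))) (changeCoords_isHomogeneous e hF)
    (changeCoords_isSmoothForm e hs) ?_ ?_ (D₁ := D₁) (D₂ := D₂) ?_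
  · refine eq_zero_of_forall_eval_algebraMap (k := k) fun t => ?_
    rw [← aeval_chartEquation e (fun s => φ (MvPolynomial.X s)), ← hφX, hφ, hP, mem_chartIdeal_iff]
    intro x s hs hx
    have h1 : chart e x ∈ fanoVariety (hypersurface F) := hx ▸ s.2
    rw [chart_mem_fanoVariety_iff e hF] at h1
    rw [← aeval_eq_eval_self, aeval_chartEquation, h1, Polynomial.eval_zero]
  -- The line coordinates generate `K` as a field over `k`.
  · intro D ha hb
    have hD : ∀ r, D (φ r) = 0 := by
      intro r
      rw [hφX, derivation_aeval]
      refine Finset.sum_eq_zero fun s _ => ?_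
      obtain ⟨i, j⟩ := s
      fin_cases i
      · exact mul_eq_zero_of_left (ha j) _
      · exact mul_eq_zero_of_left (hb j) _
    ext x
    obtain ⟨r, s, hs0, rfl⟩ := IsFractionRing.div_surjective (A := R ⧸ P) x
    obtain ⟨r, rfl⟩ := Ideal.Quotient.mk_surjective r
    obtain ⟨s, rfl⟩ := Ideal.Quotient.mk_surjective s
    have hs1 : φ s ≠ 0 := fun h => nonZeroDivisors.ne_zero hs0
      ((IsFractionRing.injective (R ⧸ P) K) (by rw [map_zero]; exact h))
    change D (φ r / φ s) = 0
    have h1 : D (φ r / φ s * φ s) = 0 := by rw [div_mul_cancel₀ _ hs1, hD]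
    rw [Derivation.leibniz, hD, smul_zero, zero_add, smul_eq_mul] at h1
    exact (mul_eq_zero.mp h1).resolve_left hs1
  · intro x y hxy
    have h1 := DFunLike.congr_fun hxy (φ u)
    have h2 := DFunLike.congr_fun hxy (φ w)
    have e1 := hD₁ none
    have e2 := hD₁ (some ())
    have e3 := hD₂ none
    have e4 := hD₂ (some ())
    simp only [Option.elim_none, Option.elim_some] at e1 e2 e3 e4
    simp [e1, e2, e3, e4] at h1 h2
    exact ⟨h1, h2⟩

end UpperBoundFano

end FanoLines

theorem lemma8p1 {k : Type*} [Field k] [IsAlgClosed k] [CharZero k]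
    (F : MvPolynomial (Fin 5) k) (hF : F.IsHomogeneous 4)
    (hX : FanoLines.IsSmoothHypersurface F) :
    (FanoLines.fanoVariety (FanoLines.hypersurface F)).Nonempty ∧
      FanoLines.HasPureDimension (FanoLines.fanoVariety (FanoLines.hypersurface F)) 1 := by
  constructor
  · obtain ⟨v, w, hvw, hline⟩ := FanoLines.exists_line_on_quartic hF
    refine ⟨⟨Submodule.span k (Set.range ![v, w]), by
      rw [finrank_span_eq_card hvw, Fintype.card_fin]⟩, ?_⟩
    refine (FanoLines.mem_fanoVariety_iff hF _).mpr fun x hx => ?_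
    change x ∈ Submodule.span k (Set.range ![v, w]) at hx
    rw [Matrix.range_cons_cons_empty] at hx
    obtain ⟨s, t, rfl⟩ := Submodule.mem_span_pair.mp hx
    exact hline s t
  · intro Z hZ
    refine le_antisymm ?_
      (FanoLines.one_le_topologicalKrullDim_of_mem_irreducibleComponents hF hZ)
    exact (topologicalKrullDim_subspace_le _ Z).trans
      (FanoLines.topologicalKrullDim_fanoVariety_le_one hF
        (FanoLines.isSmoothForm_of_isSmoothHypersurface hF hX))
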